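/- Consider a cellular network on $\mathbb{R}^2$ with $J\ge 1$ tiers of base stations. The stations of tier $j$ transmit with power $P_j>0$ and are located at the points of a homogeneous Poisson point process $\Phi_j$ of intensity $\lambda_j>0$; the processes $\Phi_1,\dots,\Phi_J$ are independent. Let $\lambda=\sum_{j=1}^J\lambda_j$ and let $\Phi=\{X_n\}$ be the superposition of the $\Phi_j$, with $Z_n\in\{1,\dots,J\}$ the tier of $X_n$. The stations carry i.i.d. shadowing marks $\mathbf S_n$, independent of the locations and tiers, which are copies of a positive measurable process $(\mathbf S(y))_{y\in\mathbb{R}^2}$ whose one-dimensional marginals are all equal to the law of a random variable $S$ with $\mathbf E[S^{2/\beta}]<\infty$. The propagation-loss from $X_n$ to $y$ is $$L_{X_n}(y)=\frac{(K|y-X_n|)^\beta}{P_{Z_n}\mathbf S_n(y-X_n)},\qquad K>0,\ \beta>2,$$ and the cell of $X\in\Phi$ is $V(X)=\{y\in\mathbb{R}^2: L_X(y)\le L_Y(y)\text{ for all }Y\in\Phi\}$. Users arrive with intensity $\gamma>0$ per unit of time and of surface and request data volumes of mean $1/\mu$, so that the traffic demand per unit of surface is $\rho=\gamma/\mu$,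 and the traffic demand in the cell of $X$ is $\rho(X)=\rho\,|V(X)|$, where $|\cdot|$ is the area. Let $\mathbf E^0$ be the expectation under the Palm probability $\mathbf P^0$ of this stationary marked point process, under which the typical station $X_0$, of tier $Z_0$, is located at the origin, and let $$\bar\rho=\mathbf E^0[\rho(0)],\qquad \bar\rho_j=\mathbf E^0[\rho(0)\mid Z_0=j]$$ be the mean traffic demands of the typical cell and of the typical cell of tier $j$. Then $$\bar\rho=\frac{\rho}{\lambda},\qquad \bar\rho_j=\bar\rho\,\frac{P_j^{2/\beta}}{P^{2/\beta}},\quad j=1,\dots,J,\qquad\text{where } P=\Big(\sum_{j=1}^J\frac{\lambda_j}{\lambda}P_j^{2/\beta}\Big)^{\beta/2}.$$ -/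

import Mathlib

open MeasureTheory ProbabilityTheory
open scoped ENNReal NNReal

noncomputable section

namespace HetNet

/-- The Euclidean plane, with Lebesgue measure `volume`. -/
abbrev Plane : Type := EuclideanSpace ℝ (Fin 2)

/-- Deterministic parameters of a network with `J` tiers of base stations. -/
structure Params (J : ℕ) where
  /-- Intensity `λ_j` of the stations of tier `j`. -/
  intensity : Fin J → ℝ
  intensity_pos : ∀ j, 0 < intensity j
  /-- Transmission power `P_j` of the stations of tier `j`. -/
  power : Fin J → ℝ
  power_pos : ∀ j, 0 < power j
  /-- Constant `K` of the path-loss function `l(x) = (K |x|) ^ β`. -/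
  K : ℝ
  K_pos : 0 < K
  /-- Exponent `β` of the path-loss function. -/
  β : ℝ
  two_lt_β : 2 < β
  /-- Intensity `γ` of user arrivals, per unit of time and of surface. -/
  γ : ℝ
  γ_pos : 0 < γ
  /-- Inverse `μ` of the mean data volume requested by a user. -/
  μ : ℝ
  μ_pos : 0 < μ

namespace Params

variable {J : ℕ} (p : Params J)

/-- Total intensity `λ = ∑ⱼ λ_j` of the stations. -/
def totalIntensity : ℝ := ∑ j, p.intensity j

/-- Traffic demand per unit of surface, `ρ = γ / μ`. -/
def demandDensity : ℝ := p.γ / p.μ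

/-- Path-loss at distance `r`, `l(r) = (K r) ^ β`. -/
def pathLoss (r : ℝ) : ℝ := (p.K * r) ^ p.β

/-- Power of the equivalent homogeneous network,
`P = (∑ⱼ (λ_j / λ) P_j ^ (2 / β)) ^ (β / 2)`. -/
def equivalentPower : ℝ :=
  (∑ j, p.intensity j / p.totalIntensity * p.power j ^ (2 / p.β)) ^ (p.β / 2)

end Params

/-- Labels of the base stations: `(j, n)` is the `n`-th station of tier `j`. -/
abbrev Station (J : ℕ) : Type := Fin J × ℕ

/-- A realization of the network: the location and the shadowing mark of each station. -/
abbrev Config (J : ℕ) (M : Type*) : Type _ := Station J → Plane × M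

/-- The network seen from `x`: all the stations are translated by `-x`, and keep their marks. -/
def Config.shift {J : ℕ} {M : Type*} (x : Plane) (c : Config J M) : Config J M :=
  fun i => ((c i).1 - x, (c i).2)

section Cells

variable {J : ℕ} {M : Type*} (p : Params J) (S : M → Plane → ℝ) (c : Config J M)

/-- Propagation-loss `l(|y - X|) / (P_Z S(y - X))` at `y` from the station `i`, located at `X`,
of tier `Z`, with shadowing field `S`. -/
def propagationLoss (i : Station J) (y : Plane) : ℝ :=
  p.pathLoss ‖y - (c i).1‖ / (p.power i.1 * S (c i).2 (y - (c i).1))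

/-- Cell of the station `i`: the locations where no station has a smaller propagation-loss. -/
def cell (i : Station J) : Set Plane :=
  {y | ∀ k : Station J, propagationLoss p S c i y ≤ propagationLoss p S c k y}

/-- Traffic demand `ρ |V|` in the cell `V` of the station `i`. -/
def trafficDemand (i : Station J) : ℝ≥0∞ :=
  ENNReal.ofReal p.demandDensity * volume (cell p S c i)

end Cells

section Probability

variable {Ω : Type*} [MeasurableSpace Ω]

/-- Number of the points `X 0, X 1, …` in `B`. -/
def count (X : ℕ → Ω → Plane) (B : Set Plane) (ω : Ω) : ℝ≥0∞ :=
  ∑' n, B.indicator (fun _ => 1) (X n ω)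

/-- The points `X 0, X 1, …` form a homogeneous Poisson point process of intensity `r`. -/
structure IsHomogeneousPoisson (r : ℝ) (X : ℕ → Ω → Plane) (Pr : Measure Ω) : Prop where
  measurable : ∀ n, Measurable (X n)
  count_law : ∀ B : Set Plane, MeasurableSet B → volume B < ∞ →
    HasLaw (count X B) ((poissonMeasure (r * volume.real B).toNNReal).map (Nat.cast : ℕ → ℝ≥0∞)) Pr
  count_indep : ∀ (k : ℕ) (B : Fin k → Set Plane), (∀ i, MeasurableSet (B i)) →
    (∀ i, volume (B i) < ∞) → Pairwise (fun i l => Disjoint (B i) (B l)) →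
    iIndepFun (fun i => count X (B i)) Pr

variable {M : Type*} [MeasurableSpace M]

/-- `S` is a shadowing field: a positive measurable stochastic process indexed by the plane, on
the probability space `(M, Q)`, whose one-dimensional marginals are all the same. -/
structure IsShadowing (S : M → Plane → ℝ) (Q : Measure M) : Prop where
  measurable : Measurable (fun q : M × Plane => S q.1 q.2)
  pos : ∀ m y, 0 < S m y
  identDistrib : ∀ y, IdentDistrib (fun m => S m y) (fun m => S m 0) Q Q

/-- The multi-tier network model: station `i` is at `X i` and has the shadowing field `S (m i)`.
The tiers are independent homogeneous Poisson point processes, and the shadowing marks `m i` are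
independent, of law `Q`, and independent of the locations. -/
structure IsNetwork {J : ℕ} (p : Params J) (Q : Measure M) (X : Station J → Ω → Plane)
    (m : Station J → Ω → M) (Pr : Measure Ω) : Prop where
  poisson : ∀ j, IsHomogeneousPoisson (p.intensity j) (fun n => X (j, n)) Pr
  tiers_indep : iIndepFun (fun (j : Fin J) (ω : Ω) (n : ℕ) => X (j, n) ω) Pr
  mark_measurable : ∀ i, Measurable (m i)
  mark_law : ∀ i, HasLaw (m i) Q Pr
  marks_indep : iIndepFun m Pr
  marks_indep_locations : IndepFun (fun ω i => X i ω) (fun ω i => m i ω) Pr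

/-- The random network realization. -/
def config {J : ℕ} (X : Station J → Ω → Plane) (m : Station J → Ω → M) (ω : Ω) : Config J M :=
  fun i => (X i ω, m i ω)

/-- Palm probability `Pr⁰` of the network, as the joint law of the label of the typical station
and of the network realization that has this station at the origin:
`Pr⁰(Γ) = (λ |B|)⁻¹ E[#{i : X_i ∈ B, (i, network seen from X_i) ∈ Γ}]`,
where `B` is a set of finite positive area. -/
def palm {J : ℕ} (p : Params J) (X : Station J → Ω → Plane) (m : Station J → Ω → M)
    (Pr : Measure Ω) (B : Set Plane) : Measure (Station J × Config J M) :=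
  (ENNReal.ofReal p.totalIntensity * volume B)⁻¹ •
    Measure.sum (fun i : Station J =>
      (Pr.restrict (X i ⁻¹' B)).map (fun ω => (i, (config X m ω).shift (X i ω))))

/-- Mean traffic demand `E⁰[ρ(0)]` of the typical cell, for a Palm probability `P₀`. -/
def meanDemand {J : ℕ} (p : Params J) (S : M → Plane → ℝ)
    (P₀ : Measure (Station J × Config J M)) : ℝ≥0∞ :=
  ∫⁻ q, trafficDemand p S q.2 q.1 ∂P₀

/-- Mean traffic demand `E⁰[ρ(0) | Z₀ = j]` of the typical cell of tier `j`. -/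
def meanDemandOfTier {J : ℕ} (p : Params J) (S : M → Plane → ℝ)
    (P₀ : Measure (Station J × Config J M)) (j : Fin J) : ℝ≥0∞ :=
  ∫⁻ q, trafficDemand p S q.2 q.1 ∂(cond P₀ {q | q.1.1 = j})

end Probability

end HetNet

end

/-! Fix a location `y` and let T be the infimum at `y` of the losses of all stations. Given the
locations, the marks are independent, so P(T ≥ t) is a Laplace functional of independent Poisson
processes, equal to exp(-∑ⱼ λ_j ∫ Q(loss from x < t) dx) (`IsNetwork.measure_minLoss_ge_eq_negExp`).
A station with effective power b = P_j S has loss below τ exactly on a disc of area (π/K²) (τ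
b)^(2/β). Hence P(T ≥ τ) = exp(-a τ^(2/β)) with a = (π/K²) E[S^(2/β)] ∑ⱼ λ_j P_j^(2/β)
(`IsNetwork.measure_ofReal_le_minLoss`). Each location is integrated separately, so only the
one-dimensional marginals of the shadowing matter.

By the Slivnyak-Mecke principle, the smallest loss over the stations other than a given one of tier
j is independent of the location and mark of that station, and has the law of T
(`IsNetwork.sum_map_eq_prod`). So `y` lies in the cell of a tier-j station at `x` with probability
E[exp(-a L^(2/β))], L being the loss from `x` to `y`. Since L^(2/β) is quadratic in |y - x|,
integrating over `y` is a Gaussian integral, with value P_j^(2/β) / ∑ᵢ λᵢ Pᵢ^(2/β): the constant K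
and the moment of S cancel (`IsNetwork.lintegral_tsum_measure_loss_le`).

Areas of cells are invariant under translation, so the Palm means are these areas, multiplied by ρ
and normalized by the mean number of stations in `B`. Summing over the tiers gives ρ/λ, and dividing
by the tier probability λ_j/λ gives the conditional means. Cells are closed under ties, and so is
the event L ≤ T, hence no null-set argument about boundaries is needed. -/

noncomputable section

namespace HetNet

open Filter Topology

/-! ### The function `u ↦ exp (-u)` on the extended nonnegative reals -/

/-- The decreasing exponential `exp (-u)` on `[0, ∞]`. -/
def negExp (u : ℝ≥0∞) : ℝ≥0∞ := EReal.exp (-(u : EReal))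

@[simp] lemma negExp_zero : negExp 0 = 1 := by simp [negExp]

@[simp] lemma negExp_top : negExp ∞ = 0 := by simp [negExp]

lemma negExp_add (u v : ℝ≥0∞) : negExp (u + v) = negExp u * negExp v := by
  rw [negExp, negExp, negExp, ← EReal.exp_add, EReal.coe_ennreal_add,
    EReal.neg_add (by simp) (by simp), sub_eq_add_neg]

lemma negExp_antitone : Antitone negExp := fun _ _ h =>
  EReal.exp_monotone (EReal.neg_le_neg_iff.2 (EReal.coe_ennreal_le_coe_ennreal_iff.2 h))

lemma negExp_le_one (u : ℝ≥0∞) : negExp u ≤ 1 := by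
  simpa using negExp_antitone (zero_le : 0 ≤ u)

lemma negExp_ne_top (u : ℝ≥0∞) : negExp u ≠ ∞ := ne_top_of_le_ne_top (by simp) (negExp_le_one u)

lemma negExp_ofReal {x : ℝ} (hx : 0 ≤ x) :
    negExp (ENNReal.ofReal x) = ENNReal.ofReal (Real.exp (-x)) := by
  rw [negExp, EReal.coe_ennreal_ofReal, max_eq_left hx, ← EReal.coe_neg, EReal.exp_coe]

lemma negExp_ne_zero {u : ℝ≥0∞} (hu : u ≠ ∞) : negExp u ≠ 0 := by
  simp [negExp, EReal.neg_eq_bot_iff, hu]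

lemma continuous_negExp : Continuous negExp :=
  ENNReal.continuous_exp.comp (continuous_neg.comp continuous_coe_ennreal_ereal)

@[fun_prop]
lemma measurable_negExp : Measurable negExp := continuous_negExp.measurable

lemma negExp_sum {ι : Type*} (s : Finset ι) (f : ι → ℝ≥0∞) :
    negExp (∑ i ∈ s, f i) = ∏ i ∈ s, negExp (f i) := by
  classical
  induction s using Finset.induction_on with
  | empty => simp
  | insert a s ha ih => rw [Finset.sum_insert ha, Finset.prod_insert ha, negExp_add, ih]

/-- This includes c = ∞, n = 0, where ∞ · 0 = 0 agrees with 0 ^ 0 = 1. -/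
lemma negExp_mul_natCast (c : ℝ≥0∞) (n : ℕ) : negExp (c * n) = negExp c ^ n := by
  induction n with
  | zero => simp
  | succ n ih => rw [Nat.cast_succ, mul_add, mul_one, negExp_add, ih, pow_succ]

/-- The function `-log` on `[0, 1]`, with values in `[0, ∞]`. -/
def negLog (g : ℝ≥0∞) : ℝ≥0∞ := (-(ENNReal.log g)).toENNReal

/-- With this inverse, an infinite product of probabilities becomes `negExp` of a sum in [0, ∞];
zero factors correspond to the value ∞. -/
lemma negExp_negLog {g : ℝ≥0∞} (hg : g ≤ 1) : negExp (negLog g) = g := by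
  have h : 0 ≤ -(ENNReal.log g) := by
    simpa using EReal.neg_le_neg_iff.2 (ENNReal.log_le_zero_iff.2 hg)
  rw [negExp, negLog, EReal.coe_toENNReal h, neg_neg, ENNReal.exp_log]

@[fun_prop]
lemma measurable_negLog : Measurable negLog :=
  measurable_ereal_toENNReal.comp (measurable_neg.comp ENNReal.measurable_log)

/-! ### Poisson laws -/

lemma lintegral_poissonMeasure_map (a : ℝ≥0) {f : ℝ≥0∞ → ℝ≥0∞} (hf : Measurable f) :
    ∫⁻ u, f u ∂((poissonMeasure a).map (Nat.cast : ℕ → ℝ≥0∞)) =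
      ∑' n : ℕ, ENNReal.ofReal (Real.exp (-a) * a ^ n / n.factorial) * f n := by
  rw [lintegral_map hf (by fun_prop), poissonMeasure, lintegral_sum_measure]
  simp [lintegral_smul_measure]

/-- With z = e^(-c), this is the generating function E[z^N] = e^(-a(1-z)), summed from the
exponential series. -/
lemma lintegral_negExp_poisson (a : ℝ≥0) (c : ℝ≥0∞) :
    ∫⁻ u, negExp (c * u) ∂((poissonMeasure a).map (Nat.cast : ℕ → ℝ≥0∞)) =
      negExp (a * (1 - negExp c)) := by
  rw [lintegral_poissonMeasure_map a (f := fun u => negExp (c * u)) (by fun_prop)]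
  simp_rw [negExp_mul_natCast]
  obtain ⟨z, hz⟩ : ∃ z : ℝ≥0, (z : ℝ≥0∞) = negExp c := ⟨_, ENNReal.coe_toNNReal (negExp_ne_top c)⟩
  have hz1 : (z : ℝ) ≤ 1 := by
    have := negExp_le_one c
    rw [← hz] at this
    exact_mod_cast this
  have hs : HasSum (fun n : ℕ => Real.exp (-a) * a ^ n / n.factorial * z ^ n)
      (Real.exp (-(a * (1 - z)))) := by
    have := (NormedSpace.expSeries_div_hasSum_exp ((a : ℝ) * z)).mul_left (Real.exp (-a))
    rw [← Real.exp_eq_exp_ℝ, ← Real.exp_add] at this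
    convert! this using 1
    · ext n; rw [mul_pow]; ring
    · ring_nf
  have hr : (a : ℝ≥0∞) * (1 - negExp c) = ENNReal.ofReal (a * (1 - z)) := by
    rw [ENNReal.ofReal_mul (by positivity), ENNReal.ofReal_sub _ (by positivity), ← hz]
    simp
  rw [hr, negExp_ofReal (mul_nonneg (by positivity) (by linarith)), ← hs.tsum_eq,
    ENNReal.ofReal_tsum_of_nonneg (fun n => by positivity) hs.summable]
  refine tsum_congr fun n => ?_
  rw [ENNReal.ofReal_mul (by positivity), ← hz, ENNReal.ofReal_pow (by positivity)]
  simp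

/-- Size-biasing a Poisson variable adds one point: (n+1) P(N = n+1) = a P(N = n). The factor e^(-c)
is the weight of the added point. This is the one-cell form of the Slivnyak-Mecke formula. -/
lemma lintegral_mul_negExp_poisson (a : ℝ≥0) (c : ℝ≥0∞) :
    ∫⁻ u, u * negExp (c * u) ∂((poissonMeasure a).map (Nat.cast : ℕ → ℝ≥0∞)) =
      a * negExp c * negExp (a * (1 - negExp c)) := by
  rw [← lintegral_negExp_poisson, lintegral_poissonMeasure_map a
    (f := fun u => u * negExp (c * u)) (by fun_prop),
    lintegral_poissonMeasure_map a (f := fun u => negExp (c * u)) (by fun_prop),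
    tsum_eq_zero_add' ENNReal.summable, ← ENNReal.tsum_mul_left]
  simp only [Nat.cast_zero, zero_mul, mul_zero, zero_add]
  refine tsum_congr fun n => ?_
  have h : ENNReal.ofReal (Real.exp (-a) * a ^ (n + 1) / (n + 1).factorial) * (n + 1 : ℕ) =
      a * ENNReal.ofReal (Real.exp (-a) * a ^ n / n.factorial) := by
    rw [← ENNReal.ofReal_coe_nnreal, ← ENNReal.ofReal_natCast, ← ENNReal.ofReal_mul (by positivity),
      ← ENNReal.ofReal_mul (by positivity)]
    congr 1
    rw [Nat.factorial_succ]
    push_cast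
    field_simp
    ring
  rw [← mul_assoc, h, negExp_mul_natCast, negExp_mul_natCast, pow_succ]
  ring

/-! ### Laplace functional and Campbell formula of a homogeneous Poisson process -/

lemma tendsto_tsum_of_monotone {ι : Type*} {u : ℕ → ι → ℝ≥0∞} {v : ι → ℝ≥0∞}
    (hu : ∀ k, Monotone fun r => u r k) (h : ∀ k, Tendsto (fun r => u r k) atTop (𝓝 (v k))) :
    Tendsto (fun r => ∑' k, u r k) atTop (𝓝 (∑' k, v k)) := by
  -- With every set measurable, the sum is an integral for the counting measure, and monotone
  -- convergence applies.
  let _ : MeasurableSpace ι := ⊤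
  simp_rw [← lintegral_count]
  exact lintegral_tendsto_of_tendsto_of_monotone (fun _ => measurable_from_top.aemeasurable)
    (ae_of_all _ hu) (ae_of_all _ h)

section Poisson

variable {Ω : Type*} [MeasurableSpace Ω] {Pr : Measure Ω} {r : ℝ} {X : ℕ → Ω → Plane}

lemma measurable_count (hX : ∀ n, Measurable (X n)) {B : Set Plane} (hB : MeasurableSet B) :
    Measurable (count X B) :=
  Measurable.tsum fun n => (measurable_const.indicator hB).comp (hX n)

lemma ofReal_mul_volume (hr : 0 ≤ r) {B : Set Plane} (hB : volume B < ∞) :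
    (((r * volume.real B).toNNReal : ℝ≥0) : ℝ≥0∞) = ENNReal.ofReal r * volume B := by
  change ENNReal.ofReal _ = _
  rw [ENNReal.ofReal_mul hr, Measure.real, ENNReal.ofReal_toReal hB.ne]

lemma IsHomogeneousPoisson.lintegral_negExp_count (hX : IsHomogeneousPoisson r X Pr) (hr : 0 ≤ r)
    {B : Set Plane} (hB : MeasurableSet B) (hB' : volume B < ∞) (c : ℝ≥0∞) :
    ∫⁻ ω, negExp (c * count X B ω) ∂Pr =
      negExp (ENNReal.ofReal r * (volume B * (1 - negExp c))) := by
  rw [(hX.count_law B hB hB').lintegral_comp (f := fun u => negExp (c * u))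
    (Measurable.aemeasurable (by fun_prop)), lintegral_negExp_poisson, ofReal_mul_volume hr hB',
    mul_assoc]

lemma IsHomogeneousPoisson.lintegral_mul_negExp_count (hX : IsHomogeneousPoisson r X Pr)
    (hr : 0 ≤ r) {B : Set Plane} (hB : MeasurableSet B) (hB' : volume B < ∞) (c : ℝ≥0∞) :
    ∫⁻ ω, count X B ω * negExp (c * count X B ω) ∂Pr =
      ENNReal.ofReal r * volume B * negExp c *
        negExp (ENNReal.ofReal r * (volume B * (1 - negExp c))) := by
  rw [(hX.count_law B hB hB').lintegral_comp (f := fun u => u * negExp (c * u))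
    (Measurable.aemeasurable (by fun_prop)), lintegral_mul_negExp_poisson, ofReal_mul_volume hr hB',
    mul_assoc (ENNReal.ofReal r) (volume B) (1 - _)]

lemma IsHomogeneousPoisson.lintegral_prod_count (hX : IsHomogeneousPoisson r X Pr)
    {ι : Type*} [Fintype ι] {B : ι → Set Plane} (hB : ∀ i, MeasurableSet (B i))
    (hB' : ∀ i, volume (B i) < ∞) (hd : Pairwise fun i l => Disjoint (B i) (B l))
    {ψ : ι → ℝ≥0∞ → ℝ≥0∞} (hψ : ∀ i, Measurable (ψ i)) :
    ∫⁻ ω, ∏ i, ψ i (count X (B i) ω) ∂Pr = ∏ i, ∫⁻ ω, ψ i (count X (B i) ω) ∂Pr := by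
  have e := Fintype.equivFin ι
  have h := hX.count_indep (Fintype.card ι) (fun i => B (e.symm i)) (fun i => hB _)
    (fun i => hB' _) (fun i l hil => hd (e.symm.injective.ne hil))
  have h' : iIndepFun (fun i => count X (B i)) Pr := by
    simpa using h.precomp e.injective
  exact lintegral_prod_eq_prod_lintegral_of_indepFun Finset.univ
    (fun i ω => ψ i (count X (B i) ω)) (h'.comp ψ hψ)
    (fun i => (hψ i).comp (measurable_count hX.measurable (hB i)))

section Step

variable {ι : Type*} [Fintype ι] {B : ι → Set Plane} {c : ι → ℝ≥0∞} {f : Plane → ℝ≥0∞}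

/-- At most one term is nonzero, so any φ vanishing at 0 passes through the sum. It serves for the
identity and for u ↦ 1 - e^(-u). -/
lemma step_apply (hd : Pairwise fun i l => Disjoint (B i) (B l))
    (hfc : ∀ i, ∀ x ∈ B i, f x = c i) (hf0 : ∀ x, (∀ i, x ∉ B i) → f x = 0)
    {φ : ℝ≥0∞ → ℝ≥0∞} (hφ : φ 0 = 0) (x : Plane) :
    φ (f x) = ∑ i, φ (c i) * (B i).indicator (fun _ => 1) x := by
  by_cases h : ∃ i, x ∈ B i
  · obtain ⟨i, hi⟩ := h
    rw [Finset.sum_eq_single i]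
    · simp [hi, hfc i x hi]
    · intro l _ hl
      have : x ∉ B l := fun h => Set.disjoint_left.1 (hd hl) h hi
      simp [this]
    · simp
  · push Not at h
    rw [hf0 x h, hφ]
    symm
    exact Finset.sum_eq_zero fun i _ => by simp [h i]

omit [MeasurableSpace Ω] in
lemma tsum_step (hd : Pairwise fun i l => Disjoint (B i) (B l))
    (hfc : ∀ i, ∀ x ∈ B i, f x = c i) (hf0 : ∀ x, (∀ i, x ∉ B i) → f x = 0) (ω : Ω) :
    ∑' k, f (X k ω) = ∑ i, c i * count X (B i) ω := by
  have h := step_apply hd hfc hf0 (φ := id) rfl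
  simp only [id] at h
  simp_rw [h, count, ← ENNReal.tsum_mul_left]
  exact Summable.tsum_finsetSum fun i _ => ENNReal.summable

lemma lintegral_step (hB : ∀ i, MeasurableSet (B i))
    (hd : Pairwise fun i l => Disjoint (B i) (B l))
    (hfc : ∀ i, ∀ x ∈ B i, f x = c i) (hf0 : ∀ x, (∀ i, x ∉ B i) → f x = 0) :
    ∫⁻ x, (1 - negExp (f x)) = ∑ i, volume (B i) * (1 - negExp (c i)) := by
  simp_rw [step_apply hd hfc hf0 (φ := fun u => 1 - negExp u) (by simp)]
  rw [lintegral_finsetSum _ fun i _ => (measurable_const.indicator (hB i)).const_mul _]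
  refine Finset.sum_congr rfl fun i _ => ?_
  rw [lintegral_const_mul _ (measurable_const.indicator (hB i)), lintegral_indicator_const (hB i),
    one_mul, mul_comm]

lemma IsHomogeneousPoisson.lintegral_negExp_step (hX : IsHomogeneousPoisson r X Pr) (hr : 0 ≤ r)
    (hB : ∀ i, MeasurableSet (B i)) (hB' : ∀ i, volume (B i) < ∞)
    (hd : Pairwise fun i l => Disjoint (B i) (B l))
    (hfc : ∀ i, ∀ x ∈ B i, f x = c i) (hf0 : ∀ x, (∀ i, x ∉ B i) → f x = 0) :
    ∫⁻ ω, negExp (∑' k, f (X k ω)) ∂Pr =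
      negExp (ENNReal.ofReal r * ∫⁻ x, (1 - negExp (f x))) := by
  simp_rw [tsum_step hd hfc hf0, negExp_sum]
  rw [hX.lintegral_prod_count hB hB' hd (ψ := fun i u => negExp (c i * u)) (fun i => by fun_prop),
    lintegral_step hB hd hfc hf0, Finset.mul_sum, negExp_sum]
  exact Finset.prod_congr rfl fun i _ => hX.lintegral_negExp_count hr (hB i) (hB' i) _

lemma tsum_eq_add_tsum_ite_zero {κ : Type*} [DecidableEq κ] (u : κ → ℝ≥0∞) (n : κ) :
    ∑' k, u k = u n + ∑' k, if k = n then 0 else u k :=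
  ENNReal.summable.tsum_eq_add_tsum_ite' n

/-- The sum over the points of `B j` turns the factor of that cell into a size-biased one, while
independence leaves the other cells unchanged. -/
lemma IsHomogeneousPoisson.campbell_step (hX : IsHomogeneousPoisson r X Pr) (hr : 0 ≤ r)
    (hB : ∀ i, MeasurableSet (B i)) (hB' : ∀ i, volume (B i) < ∞)
    (hd : Pairwise fun i l => Disjoint (B i) (B l)) (hc : ∀ i, c i ≠ ∞)
    (hfc : ∀ i, ∀ x ∈ B i, f x = c i) (hf0 : ∀ x, (∀ i, x ∉ B i) → f x = 0) (j : ι) :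
    ∑' n, ∫⁻ ω, (B j).indicator (fun _ => 1) (X n ω) *
        negExp (∑' k, if k = n then 0 else f (X k ω)) ∂Pr =
      ENNReal.ofReal r * volume (B j) *
        negExp (ENNReal.ofReal r * ∫⁻ x, (1 - negExp (f x))) := by
  classical
  have hcj := negExp_ne_zero (hc j)
  have hcj' := negExp_ne_top (c j)
  -- When `X n ω` lies in `B j`, the full sum is `c j` plus the sum over the other points. Removing
  -- the point means dividing by e^(-c j), which requires `c j` to be finite.
  have key : ∀ n ω, (B j).indicator (fun _ => 1) (X n ω) *
      negExp (∑' k, if k = n then 0 else f (X k ω)) =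
      (negExp (c j))⁻¹ * ((B j).indicator (fun _ => 1) (X n ω) *
        ∏ i, negExp (c i * count X (B i) ω)) := by
    intro n ω
    by_cases h : X n ω ∈ B j
    · rw [← negExp_sum, ← tsum_step hd hfc hf0, tsum_eq_add_tsum_ite_zero (fun k => f (X k ω)) n,
        hfc j _ h,
        negExp_add, mul_left_comm, ← mul_assoc _ (negExp (c j)), ENNReal.inv_mul_cancel hcj hcj',
        one_mul]
    · simp [h]
  have hm : Measurable fun ω => ∏ i, negExp (c i * count X (B i) ω) :=
    Finset.measurable_prod _ fun i _ =>
      measurable_negExp.comp ((measurable_count hX.measurable (hB i)).const_mul _)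
  have hm' : ∀ n, Measurable fun ω => (B j).indicator (fun _ => (1 : ℝ≥0∞)) (X n ω) := fun n =>
    (measurable_const.indicator (hB j)).comp (hX.measurable n)
  simp_rw [key]
  rw [← lintegral_tsum fun n => (((hm' n).fun_mul hm).const_mul _).aemeasurable]
  simp_rw [ENNReal.tsum_mul_left, ENNReal.tsum_mul_right]
  rw [lintegral_const_mul _ ((Measurable.tsum hm').fun_mul hm)]
  -- The indicators add up to the count of `B j`, which is absorbed into the factor of index `j`.
  have e : ∀ ω, (∑' n, (B j).indicator (fun _ => (1 : ℝ≥0∞)) (X n ω)) *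
      ∏ i, negExp (c i * count X (B i) ω) =
      ∏ i, (if i = j then count X (B i) ω * negExp (c i * count X (B i) ω) else
        negExp (c i * count X (B i) ω)) := by
    intro ω
    rw [← Finset.mul_prod_erase _ _ (Finset.mem_univ j),
      ← Finset.mul_prod_erase Finset.univ (fun i => if i = j then _ else _) (Finset.mem_univ j),
      if_pos rfl, ← mul_assoc]
    congr 1
    exact Finset.prod_congr rfl fun i hi => by rw [if_neg (Finset.ne_of_mem_erase hi)]
  simp_rw [e]
  rw [hX.lintegral_prod_count hB hB' hd
      (ψ := fun i u => if i = j then u * negExp (c i * u) else negExp (c i * u))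
      (fun i => by split_ifs <;> fun_prop),
    lintegral_step hB hd hfc hf0, Finset.mul_sum, negExp_sum,
    ← Finset.mul_prod_erase _ _ (Finset.mem_univ j),
    ← Finset.mul_prod_erase Finset.univ (fun i => negExp _) (Finset.mem_univ j)]
  simp only [if_true]
  rw [hX.lintegral_mul_negExp_count hr (hB j) (hB' j),
    Finset.prod_congr rfl fun i hi => (lintegral_congr fun ω => if_neg
      (Finset.ne_of_mem_erase hi)).trans (hX.lintegral_negExp_count hr (hB i) (hB' i) (c i))]
  -- The inverse weight of the removed point cancels the e^(-c j) produced by size-biasing.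
  have ha : ∀ z a b d : ℝ≥0∞, z⁻¹ * (a * z * b * d) = z⁻¹ * z * (a * (b * d)) :=
    fun z a b d => by ring
  rw [ha, ENNReal.inv_mul_cancel hcj hcj', one_mul]

end Step

end Poisson

/-! ### From step functions to measurable functions -/

section Poisson

variable {Ω : Type*} [MeasurableSpace Ω] {Pr : Measure Ω} {r : ℝ} {X : ℕ → Ω → Plane}

/-- The partition of `W` according to the value of `f` and the membership in `A`. -/
def valueCell (f : SimpleFunc Plane ℝ≥0∞) (A W : Set Plane) (i : f.range × Bool) : Set Plane :=
  W ∩ (f ⁻¹' {i.1.1} ∩ if i.2 then A else Aᶜ)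

lemma measurableSet_valueCell (f : SimpleFunc Plane ℝ≥0∞) {A W : Set Plane}
    (hA : MeasurableSet A) (hW : MeasurableSet W) (i : f.range × Bool) :
    MeasurableSet (valueCell f A W i) := by
  refine hW.inter ((f.measurableSet_preimage _).inter ?_)
  split_ifs
  exacts [hA, hA.compl]

lemma pairwise_disjoint_valueCell (f : SimpleFunc Plane ℝ≥0∞) (A W : Set Plane) :
    Pairwise fun i l => Disjoint (valueCell f A W i) (valueCell f A W l) := by
  rintro ⟨⟨a, ha⟩, b⟩ ⟨⟨a', ha'⟩, b'⟩ h
  refine Set.disjoint_left.2 ?_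
  rintro x ⟨-, hx, hb⟩ ⟨-, hx', hb'⟩
  apply h
  obtain rfl : a = a' := by
    have h1 : f x = a := hx
    have h2 : f x = a' := hx'
    rw [← h1, h2]
  cases b <;> cases b' <;> simp_all

lemma mem_valueCell (f : SimpleFunc Plane ℝ≥0∞) {A W : Set Plane} {x : Plane} (hx : x ∈ W) :
    ∃ i, x ∈ valueCell f A W i := by
  by_cases h : x ∈ A
  · exact ⟨(⟨f x, f.mem_range_self x⟩, true), hx, rfl, by simpa using h⟩
  · exact ⟨(⟨f x, f.mem_range_self x⟩, false), hx, rfl, by simpa using h⟩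

/-- Splitting the level sets of `f` along `A` makes `A` a finite union of cells, so `campbell_step`
can be summed over these cells. -/
lemma indicator_eq_sum_valueCell (f : SimpleFunc Plane ℝ≥0∞) {A W : Set Plane} (hA : A ⊆ W)
    (x : Plane) :
    A.indicator (fun _ => (1 : ℝ≥0∞)) x =
      ∑ v : f.range, (valueCell f A W (v, true)).indicator (fun _ => 1) x := by
  by_cases h : x ∈ A
  · rw [Finset.sum_eq_single ⟨f x, f.mem_range_self x⟩]
    · simp [valueCell, h, hA h]
    · intro v _ hv
      have : f x ≠ v.1 := fun e => hv (Subtype.ext e.symm)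
      simp [valueCell, this]
    · simp
  · simp [valueCell, h]

variable (hX : IsHomogeneousPoisson r X Pr) (hr : 0 ≤ r)
include hX hr

lemma IsHomogeneousPoisson.lintegral_negExp_simple (f : SimpleFunc Plane ℝ≥0∞)
    {W : Set Plane} (hW : MeasurableSet W) (hW' : volume W < ∞) (hf0 : ∀ x ∉ W, f x = 0) :
    ∫⁻ ω, negExp (∑' k, f (X k ω)) ∂Pr =
      negExp (ENNReal.ofReal r * ∫⁻ x, (1 - negExp (f x))) :=
  -- No set `A` is distinguished here: with A = W the cells outside `A` are empty.
  hX.lintegral_negExp_step hr (measurableSet_valueCell f hW hW)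
    (fun _ => (measure_mono Set.inter_subset_left).trans_lt hW')
    (pairwise_disjoint_valueCell f W W) (f := f) (c := fun i : f.range × Bool => i.1.1)
    (fun _ _ hx => hx.2.1)
    (fun x hx => hf0 x fun h => (mem_valueCell f h).elim hx)

lemma IsHomogeneousPoisson.campbell_simple (f : SimpleFunc Plane ℝ≥0∞) (hf : ∀ x, f x ≠ ∞)
    {A W : Set Plane} (hA : MeasurableSet A) (hAW : A ⊆ W)
    (hW : MeasurableSet W) (hW' : volume W < ∞) (hf0 : ∀ x ∉ W, f x = 0) :
    ∑' n, ∫⁻ ω, A.indicator (fun _ => 1) (X n ω) *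
        negExp (∑' k, if k = n then 0 else f (X k ω)) ∂Pr =
      ENNReal.ofReal r * volume A *
        negExp (ENNReal.ofReal r * ∫⁻ x, (1 - negExp (f x))) := by
  have hB := fun i => measurableSet_valueCell f hA hW i
  have hd := pairwise_disjoint_valueCell f A W
  have hs := fun i => hX.campbell_step hr hB
    (fun i => (measure_mono Set.inter_subset_left).trans_lt hW') hd
    (f := f) (c := fun i : f.range × Bool => i.1.1) (fun i => by
      obtain ⟨x, hx⟩ := SimpleFunc.mem_range.1 i.1.2
      exact hx ▸ hf x) (fun _ _ hx => hx.2.1)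
    (fun x hx => hf0 x fun h => (mem_valueCell f h).elim hx) i
  have hm : ∀ n, Measurable fun ω => negExp (∑' k, if k = n then 0 else f (X k ω)) := fun n =>
    measurable_negExp.comp <| Measurable.tsum fun k => by
      split_ifs
      exacts [measurable_const, f.measurable.comp (hX.measurable k)]
  have hv : volume A = ∑ v : f.range, volume (valueCell f A W (v, true)) := by
    have := lintegral_congr (μ := volume) (indicator_eq_sum_valueCell f hAW)
    rw [lintegral_finsetSum _ fun v _ => measurable_const.indicator (hB _)] at this
    simpa [lintegral_indicator_const, hA, hB] using this
  simp_rw [indicator_eq_sum_valueCell f hAW, Finset.sum_mul]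
  rw [hv, Finset.mul_sum, Finset.sum_mul, ← Finset.sum_congr rfl fun v _ => hs (v, true),
    ← Summable.tsum_finsetSum fun i _ => ENNReal.summable]
  refine tsum_congr fun n => lintegral_finsetSum _ fun v _ => Measurable.fun_mul ?_ (hm n)
  exact (measurable_const.indicator (hB _)).comp (hX.measurable n)

omit hX hr

/-- Simple functions with support of finite volume, increasing to `f`. -/
def approxFinite (f : Plane → ℝ≥0∞) (n : ℕ) : SimpleFunc Plane ℝ≥0∞ :=
  (SimpleFunc.eapprox f n).restrict (spanningSets volume n)

lemma approxFinite_apply (f : Plane → ℝ≥0∞) (n : ℕ) (x : Plane) :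
    approxFinite f n x = (spanningSets volume n).indicator (SimpleFunc.eapprox f n) x := by
  rw [approxFinite, SimpleFunc.restrict_apply _ (measurableSet_spanningSets _ _)]

lemma approxFinite_eq_zero (f : Plane → ℝ≥0∞) (n : ℕ) {x : Plane}
    (hx : x ∉ spanningSets volume n) : approxFinite f n x = 0 := by
  rw [approxFinite_apply, Set.indicator_of_notMem hx]

/-- Finite values are what the division in `campbell_step` requires of the approximations; the limit
`f` may take the value ∞. -/
lemma approxFinite_ne_top (f : Plane → ℝ≥0∞) (n : ℕ) (x : Plane) : approxFinite f n x ≠ ∞ := by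
  rw [approxFinite_apply]
  exact ne_top_of_le_ne_top (SimpleFunc.eapprox_lt_top f n x).ne (Set.indicator_le_self _ _ _)

lemma monotone_approxFinite (f : Plane → ℝ≥0∞) (x : Plane) :
    Monotone fun n => approxFinite f n x := by
  intro m n h
  simp only [approxFinite_apply]
  exact (Set.indicator_le_indicator (SimpleFunc.monotone_eapprox f h x)).trans
    (Set.indicator_le_indicator_of_subset (monotone_spanningSets volume h) (fun _ => zero_le) x)

lemma tendsto_approxFinite {f : Plane → ℝ≥0∞} (hf : Measurable f) (x : Plane) :
    Tendsto (fun n => approxFinite f n x) atTop (𝓝 (f x)) := by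
  refine (SimpleFunc.tendsto_eapprox hf x).congr' ?_
  obtain ⟨N, hN⟩ : ∃ N, x ∈ spanningSets volume N :=
    Set.mem_iUnion.1 ((iUnion_spanningSets (volume : Measure Plane)).symm ▸ Set.mem_univ x)
  filter_upwards [eventually_ge_atTop N] with n hn
  rw [approxFinite_apply, Set.indicator_of_mem (monotone_spanningSets volume hn hN)]

lemma tendsto_negExp_approxFinite {f : Plane → ℝ≥0∞} (hf : Measurable f) (a : ℝ) :
    Tendsto (fun n => negExp (ENNReal.ofReal a * ∫⁻ x, (1 - negExp (approxFinite f n x)))) atTop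
      (𝓝 (negExp (ENNReal.ofReal a * ∫⁻ x, (1 - negExp (f x))))) := by
  refine (continuous_negExp.tendsto _).comp
    (ENNReal.Tendsto.const_mul ?_ (Or.inr ENNReal.ofReal_ne_top))
  refine lintegral_tendsto_of_tendsto_of_monotone (fun n => ?_) (ae_of_all _ fun x m n h => ?_)
    (ae_of_all _ fun x => ?_)
  · exact (measurable_const.sub (measurable_negExp.comp (SimpleFunc.measurable _))).aemeasurable
  · exact tsub_le_tsub_left (negExp_antitone (monotone_approxFinite f x h)) 1
  · exact ENNReal.Tendsto.sub tendsto_const_nhds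
      ((continuous_negExp.tendsto _).comp (tendsto_approxFinite hf x)) (Or.inl ENNReal.one_ne_top)

include hX hr

/-- Laplace functional of a homogeneous Poisson process. -/
lemma IsHomogeneousPoisson.lintegral_negExp [IsProbabilityMeasure Pr] {f : Plane → ℝ≥0∞}
    (hf : Measurable f) :
    ∫⁻ ω, negExp (∑' k, f (X k ω)) ∂Pr =
      negExp (ENNReal.ofReal r * ∫⁻ x, (1 - negExp (f x))) := by
  refine tendsto_nhds_unique ?_ (tendsto_negExp_approxFinite hf r)
  simp_rw [← fun n => hX.lintegral_negExp_simple hr (approxFinite f n)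
    (measurableSet_spanningSets volume n) (measure_spanningSets_lt_top volume n)
    fun x => approxFinite_eq_zero f n]
  refine tendsto_lintegral_of_dominated_convergence (fun _ => 1) (fun n => ?_)
    (fun n => ae_of_all _ fun ω => negExp_le_one _) (by simp) (ae_of_all _ fun ω => ?_)
  · exact measurable_negExp.comp
      (Measurable.tsum fun k => (SimpleFunc.measurable _).comp (hX.measurable k))
  · exact (continuous_negExp.tendsto _).comp (tendsto_tsum_of_monotone
      (fun k => monotone_approxFinite f _) fun k => tendsto_approxFinite hf _)

/-- This is the Campbell formula with weight f = 0. -/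
lemma IsHomogeneousPoisson.tsum_measure {A : Set Plane} (hA : MeasurableSet A)
    (hA' : volume A < ∞) : ∑' n, Pr (X n ⁻¹' A) = ENNReal.ofReal r * volume A := by
  have := hX.campbell_simple hr (SimpleFunc.const _ 0) (by simp) hA subset_rfl hA hA' (by simp)
  simp only [SimpleFunc.const_zero, SimpleFunc.coe_zero, Pi.zero_apply, ite_self, tsum_zero,
    negExp_zero, mul_one, tsub_self, lintegral_zero, mul_zero] at this
  rw [← this]
  refine tsum_congr fun n => ?_
  rw [← lintegral_indicator_one (hX.measurable n hA)]
  rfl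

/-- Campbell formula for the points of a homogeneous Poisson process, each of them weighted by the
Laplace functional of the other points. -/
lemma IsHomogeneousPoisson.campbell [IsProbabilityMeasure Pr] {f : Plane → ℝ≥0∞}
    (hf : Measurable f) {A : Set Plane} (hA : MeasurableSet A) (hA' : volume A < ∞) :
    ∑' n, ∫⁻ ω, A.indicator (fun _ => 1) (X n ω) *
        negExp (∑' k, if k = n then 0 else f (X k ω)) ∂Pr =
      ENNReal.ofReal r * volume A *
        negExp (ENNReal.ofReal r * ∫⁻ x, (1 - negExp (f x))) := by
  have hlim := ENNReal.Tendsto.const_mul (a := ENNReal.ofReal r * volume A)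
    (tendsto_negExp_approxFinite hf r) (Or.inr (ENNReal.mul_ne_top ENNReal.ofReal_ne_top hA'.ne))
  refine tendsto_nhds_unique ?_ hlim
  -- The window is enlarged by `A`, which need not lie in any spanning set.
  have hs := fun m => hX.campbell_simple hr (approxFinite f m) (approxFinite_ne_top f m)
    hA (Set.subset_union_left (t := spanningSets volume m))
    (hA.union (measurableSet_spanningSets volume m))
    ((measure_union_le _ _).trans_lt (ENNReal.add_lt_top.2 ⟨hA', measure_spanningSets_lt_top _ m⟩))
    (fun x hx => approxFinite_eq_zero f m fun h => hx (Or.inr h))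
  have hA1 : ∀ n, Measurable fun ω => A.indicator (fun _ => (1 : ℝ≥0∞)) (X n ω) := fun n =>
    (measurable_const.indicator hA).comp (hX.measurable n)
  have hmeas : ∀ g : Plane → ℝ≥0∞, Measurable g → ∀ n, Measurable fun ω =>
      A.indicator (fun _ => 1) (X n ω) * negExp (∑' k, if k = n then 0 else g (X k ω)) := by
    intro g hg n
    refine (hA1 n).fun_mul (measurable_negExp.comp <| Measurable.tsum fun k => ?_)
    split_ifs
    exacts [measurable_const, hg.comp (hX.measurable k)]
  -- Sum and expectation form one integral over ℕ × Ω, so a single dominated convergence handles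
  -- both. The dominating function integrates to the mean number of points in `A`.
  have hprod : ∀ g : ℕ → Ω → ℝ≥0∞, (∀ n, Measurable (g n)) →
      ∑' n, ∫⁻ ω, g n ω ∂Pr = ∫⁻ z, g z.1 z.2 ∂(Measure.count.prod Pr) := by
    intro g hg
    rw [lintegral_prod _ (measurable_from_prod_countable_right hg).aemeasurable, lintegral_count]
  simp_rw [← hs]
  rw [hprod _ (hmeas f hf)]
  simp_rw [fun m => hprod _ (hmeas (approxFinite f m) (SimpleFunc.measurable _))]
  refine tendsto_lintegral_of_dominated_convergence
    (fun z : ℕ × Ω => A.indicator (fun _ => 1) (X z.1 z.2)) (fun m => ?_)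
    (fun m => ae_of_all _ fun z => mul_le_of_le_one_right zero_le (negExp_le_one _)) ?_
    (ae_of_all _ fun z => ?_)
  · exact measurable_from_prod_countable_right
      (hmeas (approxFinite f m) (SimpleFunc.measurable _))
  · rw [← hprod (fun n ω => A.indicator (fun _ => 1) (X n ω)) hA1]
    have : ∀ n, ∫⁻ ω, A.indicator (fun _ => (1 : ℝ≥0∞)) (X n ω) ∂Pr = Pr (X n ⁻¹' A) := by
      intro n
      rw [← lintegral_indicator_one (hX.measurable n hA)]
      rfl
    simp_rw [this, hX.tsum_measure hr hA hA']
    exact ENNReal.mul_ne_top ENNReal.ofReal_ne_top hA'.ne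
  · refine ENNReal.Tendsto.const_mul ((continuous_negExp.tendsto _).comp
      (tendsto_tsum_of_monotone (fun k => ?_) fun k => ?_)) (Or.inr ?_)
    · by_cases h : k = z.1
      · simp [h, monotone_const]
      · simpa [h] using monotone_approxFinite f _
    · by_cases h : k = z.1
      · simp [h]
      · simpa [h] using tendsto_approxFinite hf _
    · exact ne_top_of_le_ne_top ENNReal.one_ne_top (Set.indicator_le_self' (by simp) _)

end Poisson

/-! ### Superposition of independent tiers -/

section Tiers

variable {Ω : Type*} [MeasurableSpace Ω] {Pr : Measure Ω} [IsProbabilityMeasure Pr] {J : ℕ}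
  {r : Fin J → ℝ} {X : Station J → Ω → Plane}

omit [IsProbabilityMeasure Pr] in
lemma lintegral_prod_tiers (hX : ∀ i, Measurable (X i))
    (hind : iIndepFun (fun (j : Fin J) (ω : Ω) (n : ℕ) => X (j, n) ω) Pr)
    {ψ : Fin J → (ℕ → Plane) → ℝ≥0∞} (hψ : ∀ j, Measurable (ψ j)) :
    ∫⁻ ω, ∏ j, ψ j (fun n => X (j, n) ω) ∂Pr = ∏ j, ∫⁻ ω, ψ j (fun n => X (j, n) ω) ∂Pr :=
  lintegral_prod_eq_prod_lintegral_of_indepFun Finset.univ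
    (fun j ω => ψ j (fun n => X (j, n) ω)) (hind.comp ψ hψ)
    (fun j => (hψ j).comp (measurable_pi_lambda _ fun n => hX (j, n)))

variable (hX : ∀ j, IsHomogeneousPoisson (r j) (fun n => X (j, n)) Pr) (hr : ∀ j, 0 ≤ r j)
  (hind : iIndepFun (fun (j : Fin J) (ω : Ω) (n : ℕ) => X (j, n) ω) Pr)
include hX hr hind

/-- Laplace functional of the superposition of independent Poisson processes. -/
lemma lintegral_negExp_tiers {f : Fin J → Plane → ℝ≥0∞} (hf : ∀ j, Measurable (f j)) :
    ∫⁻ ω, negExp (∑' i : Station J, f i.1 (X i ω)) ∂Pr =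
      ∏ j, negExp (ENNReal.ofReal (r j) * ∫⁻ x, (1 - negExp (f j x))) := by
  have h : ∀ ω, negExp (∑' i : Station J, f i.1 (X i ω)) =
      ∏ j, negExp (∑' n, f j (X (j, n) ω)) := by
    intro ω
    rw [ENNReal.tsum_prod', tsum_fintype, negExp_sum]
  simp_rw [h]
  rw [lintegral_prod_tiers (fun i => (hX i.1).measurable i.2) hind
    (ψ := fun j x => negExp (∑' n, f j (x n)))
    (fun j => measurable_negExp.comp
      (Measurable.tsum fun n => (hf j).comp (measurable_pi_apply n)))]
  exact Finset.prod_congr rfl fun j _ => (hX j).lintegral_negExp (hr j) (hf j)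

/-- Campbell formula for the points of the tier `j`, weighted by the Laplace functional of all the
other points of the network. -/
lemma campbell_tiers {f : Fin J → Plane → ℝ≥0∞} (hf : ∀ j, Measurable (f j)) (j : Fin J)
    {A : Set Plane} (hA : MeasurableSet A) (hA' : volume A < ∞) :
    ∑' n, ∫⁻ ω, A.indicator (fun _ => 1) (X (j, n) ω) *
        negExp (∑' i : Station J, if i = (j, n) then 0 else f i.1 (X i ω)) ∂Pr =
      ENNReal.ofReal (r j) * volume A *
        ∫⁻ ω, negExp (∑' i : Station J, f i.1 (X i ω)) ∂Pr := by
  -- Only the factor of tier `j` involves the removed point. It will be given by the one-tier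
  -- Campbell formula, and the other factors by the Laplace functional.
  have h : ∀ n ω, A.indicator (fun _ => 1) (X (j, n) ω) *
        negExp (∑' i : Station J, if i = (j, n) then 0 else f i.1 (X i ω)) =
      ∏ l, (if l = j then A.indicator (fun _ => 1) (X (l, n) ω) *
        negExp (∑' k, if k = n then 0 else f l (X (l, k) ω)) else
          negExp (∑' k, f l (X (l, k) ω))) := by
    intro n ω
    rw [ENNReal.tsum_prod', tsum_fintype, negExp_sum,
      ← Finset.mul_prod_erase _ _ (Finset.mem_univ j),
      ← Finset.mul_prod_erase Finset.univ (fun l => if l = j then _ else _) (Finset.mem_univ j),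
      ← mul_assoc, if_pos rfl]
    congr 1
    · simp
    · refine Finset.prod_congr rfl fun l hl => ?_
      have hl := Finset.ne_of_mem_erase hl
      simp [hl]
  have hm : ∀ l, Measurable fun x : ℕ → Plane => negExp (∑' k, f l (x k)) := fun l =>
    measurable_negExp.comp (Measurable.tsum fun n => (hf l).comp (measurable_pi_apply n))
  have hm' : ∀ n l, Measurable fun x : ℕ → Plane => A.indicator (fun _ => 1) (x n) *
      negExp (∑' k, if k = n then 0 else f l (x k)) := by
    intro n l
    refine ((measurable_const.indicator hA).comp (measurable_pi_apply n)).mul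
      (measurable_negExp.comp (Measurable.tsum fun k => ?_))
    split_ifs
    exacts [measurable_const, (hf l).comp (measurable_pi_apply k)]
  have hprod : ∀ n, ∫⁻ ω, A.indicator (fun _ => 1) (X (j, n) ω) *
        negExp (∑' i : Station J, if i = (j, n) then 0 else f i.1 (X i ω)) ∂Pr =
      (∫⁻ ω, A.indicator (fun _ => 1) (X (j, n) ω) *
        negExp (∑' k, if k = n then 0 else f j (X (j, k) ω)) ∂Pr) *
        ∏ l ∈ Finset.univ.erase j,
          negExp (ENNReal.ofReal (r l) * ∫⁻ x, (1 - negExp (f l x))) := by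
    intro n
    simp_rw [h]
    rw [lintegral_prod_tiers (fun i => (hX i.1).measurable i.2) hind
      (ψ := fun l x => if l = j then A.indicator (fun _ => 1) (x n) *
        negExp (∑' k, if k = n then 0 else f l (x k)) else negExp (∑' k, f l (x k)))
      (fun l => by
        split_ifs
        exacts [hm' n l, hm l]),
      ← Finset.mul_prod_erase _ _ (Finset.mem_univ j)]
    congr 1
    · simp
    · refine Finset.prod_congr rfl fun l hl => ?_
      simp only [if_neg (Finset.ne_of_mem_erase hl)]
      exact (hX l).lintegral_negExp (hr l) (hf l)
  simp_rw [hprod]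
  rw [ENNReal.tsum_mul_right, (hX j).campbell (hr j) (hf j) hA hA',
    lintegral_negExp_tiers hX hr hind hf, mul_assoc,
    Finset.mul_prod_erase Finset.univ
      (fun l => negExp (ENNReal.ofReal (r l) * ∫⁻ x, (1 - negExp (f l x)))) (Finset.mem_univ j)]

end Tiers

/-! ### Independent marks and conditioning on the locations -/

section Marks

variable {Ω : Type*} [MeasurableSpace Ω] {Pr : Measure Ω} [IsProbabilityMeasure Pr]
  {M : Type*} [MeasurableSpace M] {Q : Measure M} [IsProbabilityMeasure Q]

/-- Independence gives the product over finite subfamilies; continuity from above along the finite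
subsets gives the limit. -/
lemma measure_forall_mem_eq_negExp {κ : Type*} [Countable κ] {m : κ → Ω → M}
    (hm : ∀ k, Measurable (m k)) (hlaw : ∀ k, HasLaw (m k) Q Pr) (hind : iIndepFun m Pr)
    {G : κ → Set M} (hG : ∀ k, MeasurableSet (G k)) :
    Pr {ω | ∀ k, m k ω ∈ G k} = negExp (∑' k, negLog (Q (G k))) := by
  have hfin : ∀ s : Finset κ, Pr (⋂ k ∈ s, m k ⁻¹' G k) = negExp (∑ k ∈ s, negLog (Q (G k))) := by
    intro s
    rw [hind.measure_inter_preimage_eq_mul s fun k _ => hG k, negExp_sum]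
    refine Finset.prod_congr rfl fun k _ => ?_
    rw [negExp_negLog prob_le_one, ← (hlaw k).map_eq, Measure.map_apply (hm k) (hG k)]
  have h1 : Tendsto (fun s : Finset κ => negExp (∑ k ∈ s, negLog (Q (G k)))) atTop
      (𝓝 (negExp (∑' k, negLog (Q (G k))))) :=
    (continuous_negExp.tendsto _).comp ENNReal.summable.hasSum
  have h2 : Tendsto (fun s : Finset κ => Pr (⋂ k ∈ s, m k ⁻¹' G k)) atTop
      (𝓝 (Pr (⋂ s : Finset κ, ⋂ k ∈ s, m k ⁻¹' G k))) :=
    tendsto_measure_iInter_atTop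
      (fun s => (Finset.measurableSet_biInter s fun k _ => hm k (hG k)).nullMeasurableSet)
      (fun s t h => Set.biInter_mono h fun _ _ => subset_rfl) ⟨∅, measure_ne_top _ _⟩
  simp_rw [hfin] at h2
  rw [← tendsto_nhds_unique h2 h1]
  congr 1
  ext ω
  simp only [Set.mem_ofPred_eq, Set.mem_iInter, Set.mem_preimage]
  exact ⟨fun h _ k _ => h k, fun h k => h {k} k (by simp)⟩

/-- By Fubini for the product law, `U` can be frozen. It is used with the locations as `U` and the
marks as `V`. -/
lemma measure_mem_eq_lintegral_of_indepFun {α β : Type*} [MeasurableSpace α] [MeasurableSpace β]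
    {U : Ω → α} {V : Ω → β} (hU : Measurable U) (hV : Measurable V) (hUV : IndepFun U V Pr)
    {D : Set (α × β)} (hD : MeasurableSet D) :
    Pr {ω | (U ω, V ω) ∈ D} = ∫⁻ ω, Pr {ω' | (U ω, V ω') ∈ D} ∂Pr := by
  have h := (indepFun_iff_map_prod_eq_prod_map_map hU.aemeasurable hV.aemeasurable).1 hUV
  have : Pr {ω | (U ω, V ω) ∈ D} = (Pr.map fun ω => (U ω, V ω)) D :=
    (Measure.map_apply (hU.prodMk hV) hD).symm
  rw [this, h, Measure.prod_apply hD, lintegral_map (measurable_measure_prodMk_left hD) hU]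
  refine lintegral_congr fun ω => ?_
  rw [Measure.map_apply hV (measurable_prodMk_left hD)]
  rfl

end Marks

/-- Smallest loss over the stations, where the station `i` has the loss `u i`. -/
def minLoss {κ : Type*} (u : κ → ℝ≥0∞) : ℝ≥0∞ := ⨅ k, u k

/-- Smallest loss over the stations other than `i`. -/
def minLossExcept {κ : Type*} (u : κ → ℝ≥0∞) (i : κ) : ℝ≥0∞ := ⨅ k, ⨅ _ : k ≠ i, u k

/-! ### Law of the smallest loss and Slivnyak-Mecke formula for the marked network -/

section Network

variable {Ω : Type*} [MeasurableSpace Ω] {Pr : Measure Ω} [IsProbabilityMeasure Pr]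
  {M : Type*} [MeasurableSpace M] {Q : Measure M} [IsProbabilityMeasure Q]
  {J : ℕ} {p : Params J} {X : Station J → Ω → Plane} {m : Station J → Ω → M}
  (hnet : IsNetwork p Q X m Pr)
  {ℓ : Fin J → Plane → M → ℝ≥0∞} (hℓ : ∀ j, Measurable fun q : Plane × M => ℓ j q.1 q.2)

omit [IsProbabilityMeasure Pr] [IsProbabilityMeasure Q] in
include hnet in
lemma IsNetwork.measurable_location (i : Station J) : Measurable (X i) :=
  (hnet.poisson i.1).measurable i.2

/-- `-log` of the probability that the loss of a station of tier `j` located at `x` is at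
least `t`. -/
def negLogTail (Q : Measure M) (ℓ : Fin J → Plane → M → ℝ≥0∞) (t : ℝ≥0∞) (j : Fin J)
    (x : Plane) : ℝ≥0∞ :=
  negLog (Q {s | t ≤ ℓ j x s})

include hℓ

omit [MeasurableSpace Ω] [IsProbabilityMeasure Pr] [IsProbabilityMeasure Q] in
lemma measurable_loss_comp {α : Type*} [MeasurableSpace α] (j : Fin J) {u : α → Plane} {v : α → M}
    (hu : Measurable u) (hv : Measurable v) : Measurable fun a => ℓ j (u a) (v a) :=
  (hℓ j).comp (hu.prodMk hv)

omit [IsProbabilityMeasure Q] in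
lemma measurableSet_loss_ge (t : ℝ≥0∞) (j : Fin J) (x : Plane) :
    MeasurableSet {s | t ≤ ℓ j x s} :=
  measurableSet_le measurable_const ((hℓ j).comp measurable_prodMk_left)

lemma measurable_measure_loss_ge (t : ℝ≥0∞) (j : Fin J) :
    Measurable fun x => Q {s | t ≤ ℓ j x s} :=
  measurable_measure_prodMk_left (s := {q : Plane × M | t ≤ ℓ j q.1 q.2})
    (measurableSet_le measurable_const (hℓ j))

lemma measurable_negLogTail (t : ℝ≥0∞) (j : Fin J) : Measurable (negLogTail Q ℓ t j) :=
  measurable_negLog.comp (measurable_measure_loss_ge hℓ t j)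

include hnet

omit [IsProbabilityMeasure Pr] [IsProbabilityMeasure Q] in
lemma IsNetwork.measurable_loss (i : Station J) :
    Measurable fun ω => ℓ i.1 (X i ω) (m i ω) :=
  (hℓ i.1).comp ((hnet.measurable_location i).prodMk (hnet.mark_measurable i))

omit [IsProbabilityMeasure Pr] [IsProbabilityMeasure Q] in
lemma IsNetwork.measurable_minLoss :
    Measurable fun ω => minLoss fun i : Station J => ℓ i.1 (X i ω) (m i ω) :=
  Measurable.iInf fun i => hnet.measurable_loss hℓ i

omit [IsProbabilityMeasure Pr] [IsProbabilityMeasure Q] in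
lemma IsNetwork.measurable_minLossExcept (i : Station J) :
    Measurable fun ω => minLossExcept (fun k : Station J => ℓ k.1 (X k ω) (m k ω)) i :=
  Measurable.iInf fun k => Measurable.iInf fun _ => hnet.measurable_loss hℓ k

lemma IsNetwork.measure_minLoss_ge (t : ℝ≥0∞) :
    Pr {ω | t ≤ minLoss fun i : Station J => ℓ i.1 (X i ω) (m i ω)} =
      ∫⁻ ω, negExp (∑' i : Station J, negLogTail Q ℓ t i.1 (X i ω)) ∂Pr := by
  have hD : MeasurableSet {q : (Station J → Plane) × (Station J → M) |
      ∀ k : Station J, t ≤ ℓ k.1 (q.1 k) (q.2 k)} := by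
    rw [Set.ofPred_forall]
    exact MeasurableSet.iInter fun k => measurableSet_le measurable_const
      (measurable_loss_comp hℓ k.1
      ((measurable_pi_apply k).comp measurable_fst) ((measurable_pi_apply k).comp measurable_snd))
  have h := measure_mem_eq_lintegral_of_indepFun
    (measurable_pi_lambda (fun ω i => X i ω) hnet.measurable_location)
    (measurable_pi_lambda (fun ω i => m i ω) hnet.mark_measurable)
    hnet.marks_indep_locations hD
  simp only [minLoss, le_iInf_iff]
  refine h.trans (lintegral_congr fun ω => ?_)
  exact measure_forall_mem_eq_negExp hnet.mark_measurable hnet.mark_law hnet.marks_indep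
    (G := fun k => {s | t ≤ ℓ k.1 (X k ω) s}) fun k => measurableSet_loss_ge hℓ t _ _

lemma IsNetwork.measure_minLossExcept_ge (t : ℝ≥0∞) (i : Station J) {A : Set Plane}
    (hA : MeasurableSet A) {D : Set M} (hD : MeasurableSet D) :
    Pr {ω | X i ω ∈ A ∧ m i ω ∈ D ∧
        t ≤ minLossExcept (fun k : Station J => ℓ k.1 (X k ω) (m k ω)) i} =
      ∫⁻ ω, Q D * (A.indicator (fun _ => 1) (X i ω) *
        negExp (∑' k : Station J, if k = i then 0 else negLogTail Q ℓ t k.1 (X k ω))) ∂Pr := by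
  have hE : MeasurableSet {q : (Station J → Plane) × (Station J → M) |
      q.1 i ∈ A ∧ q.2 i ∈ D ∧ ∀ k, k ≠ i → t ≤ ℓ k.1 (q.1 k) (q.2 k)} := by
    refine MeasurableSet.inter (((measurable_pi_apply i).comp measurable_fst) hA)
      (MeasurableSet.inter (((measurable_pi_apply i).comp measurable_snd) hD) ?_)
    change MeasurableSet {q : (Station J → Plane) × (Station J → M) |
      ∀ k, k ≠ i → t ≤ ℓ k.1 (q.1 k) (q.2 k)}
    simp_rw [Set.ofPred_forall]
    exact MeasurableSet.iInter fun k => MeasurableSet.iInter fun _ =>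
      measurableSet_le measurable_const
      (measurable_loss_comp hℓ k.1
      ((measurable_pi_apply k).comp measurable_fst) ((measurable_pi_apply k).comp measurable_snd))
  have h := measure_mem_eq_lintegral_of_indepFun
    (measurable_pi_lambda (fun ω i => X i ω) hnet.measurable_location)
    (measurable_pi_lambda (fun ω i => m i ω) hnet.mark_measurable)
    hnet.marks_indep_locations hE
  simp only [minLossExcept, le_iInf_iff]
  refine h.trans (lintegral_congr fun ω => ?_)
  by_cases hx : X i ω ∈ A
  · have hG := measure_forall_mem_eq_negExp hnet.mark_measurable hnet.mark_law hnet.marks_indep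
      -- The constraint on the mark of `i` takes the place of its loss constraint, and contributes
      -- the factor `Q D`.
      (G := fun k => if k = i then D else {s | t ≤ ℓ k.1 (X k ω) s}) fun k => by
        split_ifs
        exacts [hD, measurableSet_loss_ge hℓ t _ _]
    rw [tsum_eq_add_tsum_ite_zero _ i, negExp_add, if_pos rfl, negExp_negLog prob_le_one] at hG
    rw [Set.indicator_of_mem hx, one_mul]
    convert hG using 3
    · ext ω'
      simp only [Set.mem_ofPred_eq, hx, true_and]
      constructor
      · rintro ⟨h1, h2⟩ k
        split_ifs with hk
        · exact hk ▸ h1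
        · exact h2 k hk
      · intro h
        refine ⟨by simpa using h i, fun k hk => ?_⟩
        simpa [hk] using h k
    · refine tsum_congr fun k => ?_
      split_ifs with hk <;> rfl
  · simp [hx]

/-- Removing the typical station leaves a network with the original law: the right side contains the
smallest loss over all the stations. -/
lemma IsNetwork.tsum_measure_minLossExcept_ge (t : ℝ≥0∞) (j : Fin J) {A : Set Plane}
    (hA : MeasurableSet A) (hA' : volume A < ∞) {D : Set M} (hD : MeasurableSet D) :
    ∑' n, Pr {ω | X (j, n) ω ∈ A ∧ m (j, n) ω ∈ D ∧
        t ≤ minLossExcept (fun k : Station J => ℓ k.1 (X k ω) (m k ω)) (j, n)} =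
      ENNReal.ofReal (p.intensity j) * volume A * (Q D *
        Pr {ω | t ≤ minLoss fun i : Station J => ℓ i.1 (X i ω) (m i ω)}) := by
  simp_rw [hnet.measure_minLossExcept_ge hℓ t _ hA hD]
  have hf := measurable_negLogTail (Q := Q) hℓ t
  have hm : ∀ i, Measurable fun ω => A.indicator (fun _ => 1) (X i ω) *
      negExp (∑' k : Station J, if k = i then 0 else negLogTail Q ℓ t k.1 (X k ω)) := by
    intro i
    refine ((measurable_const.indicator hA).comp (hnet.measurable_location i)).fun_mul
      (measurable_negExp.comp (Measurable.tsum fun k => ?_))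
    split_ifs
    exacts [measurable_const, (hf k.1).comp (hnet.measurable_location k)]
  rw [tsum_congr fun n => lintegral_const_mul (Q D) (hm (j, n)), ENNReal.tsum_mul_left,
    campbell_tiers hnet.poisson (fun j => (p.intensity_pos j).le)
    hnet.tiers_indep hf j hA hA', hnet.measure_minLoss_ge hℓ]
  ring

/-- Campbell measure of the stations of tier `j` located in `B`, with their marks and the smallest
loss of the other stations. -/
lemma IsNetwork.sum_map_eq_prod (j : Fin J) {B : Set Plane} (hB : MeasurableSet B)
    (hB' : volume B < ∞) :
    Measure.sum (fun n => (Pr.restrict (X (j, n) ⁻¹' B)).map fun ω => (X (j, n) ω, m (j, n) ω,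
        minLossExcept (fun k : Station J => ℓ k.1 (X k ω) (m k ω)) (j, n))) =
      (ENNReal.ofReal (p.intensity j) • volume.restrict B).prod
        (Q.prod (Pr.map fun ω => minLoss fun i : Station J => ℓ i.1 (X i ω) (m i ω))) := by
  have hmeas : ∀ n, Measurable fun ω => (X (j, n) ω, m (j, n) ω,
        minLossExcept (fun k : Station J => ℓ k.1 (X k ω) (m k ω)) (j, n)) := fun n =>
    (hnet.measurable_location _).prodMk
      ((hnet.mark_measurable _).prodMk (hnet.measurable_minLossExcept hℓ _))
  have hT := hnet.measurable_minLoss hℓ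
  have : IsProbabilityMeasure
      (Pr.map fun ω => minLoss fun i : Station J => ℓ i.1 (X i ω) (m i ω)) :=
    Measure.isProbabilityMeasure_map hT.aemeasurable
  have : IsFiniteMeasure (volume.restrict B) := ⟨by simpa using hB'⟩
  have : IsFiniteMeasure (ENNReal.ofReal (p.intensity j) • volume.restrict B) :=
    Measure.smul_finite _ ENNReal.ofReal_ne_top
  symm
  refine Measure.ext_prod₃ fun {A D E} hA hD hE => ?_
  set μ := (ENNReal.ofReal (p.intensity j) • volume.restrict B).prod
        (Q.prod (Pr.map fun ω => minLoss fun i : Station J => ℓ i.1 (X i ω) (m i ω)))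
  set ν := Measure.sum (fun n => (Pr.restrict (X (j, n) ⁻¹' B)).map
    fun ω => (X (j, n) ω, m (j, n) ω,
        minLossExcept (fun k : Station J => ℓ k.1 (X k ω) (m k ω)) (j, n)))
  have hproj : Measurable fun q : Plane × M × ℝ≥0∞ => q.2.2 := measurable_snd.comp measurable_snd
  have hap : ∀ (κ : Measure (Plane × M × ℝ≥0∞)) {F : Set ℝ≥0∞}, MeasurableSet F →
      ((κ.restrict (A ×ˢ D ×ˢ Set.univ)).map fun q => q.2.2) F = κ (A ×ˢ D ×ˢ F) := by
    intro κ F hF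
    rw [Measure.map_apply hproj hF, Measure.restrict_apply (hproj hF)]
    congr 1
    ext q
    simp only [Set.mem_inter_iff, Set.mem_preimage, Set.mem_prod, Set.mem_univ, and_true]
    tauto
  -- With `A` and `D` fixed, both sides are measures in the last coordinate, determined by their
  -- values on the intervals [t, ∞].
  have hkey : (μ.restrict (A ×ˢ D ×ˢ Set.univ)).map (fun q => q.2.2) =
      (ν.restrict (A ×ˢ D ×ˢ Set.univ)).map fun q => q.2.2 := by
    refine Measure.ext_of_Ici _ _ fun t => ?_
    rw [hap _ measurableSet_Ici, hap _ measurableSet_Ici, Measure.prod_prod, Measure.prod_prod,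
      Measure.map_apply hT measurableSet_Ici,
      Measure.sum_apply _ (hA.prod (hD.prod measurableSet_Ici)), Measure.smul_apply, smul_eq_mul,
      Measure.restrict_apply hA]
    refine (hnet.tsum_measure_minLossExcept_ge hℓ t j (hA.inter hB)
      ((measure_mono Set.inter_subset_right).trans_lt hB') hD).symm.trans
      (tsum_congr fun n => ?_)
    rw [Measure.map_apply (hmeas n) (hA.prod (hD.prod measurableSet_Ici)),
      Measure.restrict_apply (hmeas n (hA.prod (hD.prod measurableSet_Ici)))]
    congr 1
    ext ω
    simp only [Set.mem_ofPred_eq, Set.mem_inter_iff, Set.mem_preimage, Set.mem_prod, Set.mem_Ici]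
    tauto
  rw [← hap μ hE, ← hap ν hE, hkey]

/-- The Campbell measure is evaluated on the set where the loss of the station is at most the
smallest loss of the others; comparing a station with itself costs nothing. -/
lemma IsNetwork.tsum_measure_loss_le (j : Fin J) {B : Set Plane} (hB : MeasurableSet B)
    (hB' : volume B < ∞) :
    ∑' n, Pr {ω | X (j, n) ω ∈ B ∧
        ∀ k : Station J, ℓ j (X (j, n) ω) (m (j, n) ω) ≤ ℓ k.1 (X k ω) (m k ω)} =
      ENNReal.ofReal (p.intensity j) * ∫⁻ x in B, ∫⁻ s,
        Pr {ω | ℓ j x s ≤ minLoss fun i : Station J => ℓ i.1 (X i ω) (m i ω)} ∂Q := by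
  have hT := hnet.measurable_minLoss hℓ
  have : IsProbabilityMeasure
      (Pr.map fun ω => minLoss fun i : Station J => ℓ i.1 (X i ω) (m i ω)) :=
    Measure.isProbabilityMeasure_map hT.aemeasurable
  have hS : MeasurableSet {q : Plane × M × ℝ≥0∞ | ℓ j q.1 q.2.1 ≤ q.2.2} :=
    measurableSet_le ((hℓ j).comp
      (measurable_fst.prodMk (measurable_fst.comp measurable_snd)))
      (measurable_snd.comp measurable_snd)
  have h := congrArg (fun κ : Measure (Plane × M × ℝ≥0∞) => κ {q | ℓ j q.1 q.2.1 ≤ q.2.2})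
    (hnet.sum_map_eq_prod hℓ j hB hB')
  have hmeas : ∀ n, Measurable fun ω => (X (j, n) ω, m (j, n) ω,
        minLossExcept (fun k : Station J => ℓ k.1 (X k ω) (m k ω)) (j, n)) := fun n =>
    (hnet.measurable_location _).prodMk
      ((hnet.mark_measurable _).prodMk (hnet.measurable_minLossExcept hℓ _))
  beta_reduce at h
  rw [Measure.sum_apply _ hS, Measure.prod_apply hS, lintegral_smul_measure, smul_eq_mul] at h
  convert h using 1
  · refine tsum_congr fun n => ?_
    rw [Measure.map_apply (hmeas n) hS, Measure.restrict_apply (hmeas n hS)]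
    congr 1
    ext ω
    simp only [Set.mem_ofPred_eq, Set.mem_inter_iff, Set.mem_preimage, minLossExcept, le_iInf_iff]
    constructor
    · rintro ⟨h1, h2⟩
      exact ⟨fun k _ => h2 k, h1⟩
    · rintro ⟨h1, h2⟩
      refine ⟨h2, fun k => ?_⟩
      by_cases hk : k = (j, n)
      · rw [hk]
      · exact h1 k hk
  · congr 1
    refine lintegral_congr fun x => ?_
    rw [Measure.prod_apply (measurable_prodMk_left hS)]
    refine lintegral_congr fun s => ?_
    rw [Measure.map_apply hT (measurable_prodMk_left (measurable_prodMk_left hS))]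
    rfl

/-- In the Laplace functional with f = `negLogTail`, the term 1 - e^(-f(x)) is the probability that
a station at `x` has loss below `t`. -/
lemma IsNetwork.measure_minLoss_ge_eq_negExp (t : ℝ≥0∞) :
    Pr {ω | t ≤ minLoss fun i : Station J => ℓ i.1 (X i ω) (m i ω)} =
      negExp (∑ j, ENNReal.ofReal (p.intensity j) * ∫⁻ x, Q {s | ℓ j x s < t}) := by
  rw [hnet.measure_minLoss_ge hℓ, lintegral_negExp_tiers hnet.poisson
    (fun j => (p.intensity_pos j).le) hnet.tiers_indep (measurable_negLogTail hℓ t), negExp_sum]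
  refine Finset.prod_congr rfl fun j _ => ?_
  congr 2
  refine lintegral_congr fun x => ?_
  rw [negLogTail, negExp_negLog prob_le_one,
    ← prob_compl_eq_one_sub (measurableSet_loss_ge hℓ t j x)]
  congr 1
  ext s
  simp

end Network

/-! ### Explicit computations for the power-law path-loss -/

section Loss

variable {J : ℕ} (p : Params J) {M : Type*} [MeasurableSpace M] {Q : Measure M}
  [IsProbabilityMeasure Q] {S : M → Plane → ℝ} (hS : IsShadowing S Q)

lemma Params.β_pos : 0 < p.β := by linarith [p.two_lt_β]

lemma Params.measurable_pathLoss : Measurable p.pathLoss := by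
  unfold Params.pathLoss
  fun_prop

lemma Params.pathLoss_nonneg {r : ℝ} (hr : 0 ≤ r) : 0 ≤ p.pathLoss r :=
  Real.rpow_nonneg (mul_nonneg p.K_pos.le hr) _

/-- Powers weighted by the intensities, `∑ⱼ λ_j P_j ^ (2 / β)`. -/
def Params.weightedPower : ℝ := ∑ j, p.intensity j * p.power j ^ (2 / p.β)

/-- Fractional moment `E[S ^ (2 / β)]` of the shadowing. -/
def Params.shadowingMoment (S : M → Plane → ℝ) (Q : Measure M) : ℝ :=
  ∫ s, S s 0 ^ (2 / p.β) ∂Q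

omit [IsProbabilityMeasure Q] in
include hS in
lemma IsShadowing.measurable_apply (u : Plane) : Measurable fun s => S s u :=
  hS.measurable.comp measurable_prodMk_right

omit [MeasurableSpace M] in
-- The exponent 2/β makes the path-loss quadratic in the distance, which gives discs and Gaussian
-- integrals below.
lemma div_rpow_two_div {a b : ℝ} (ha : 0 ≤ a) (hb : 0 < b) :
    (p.pathLoss a / b) ^ (2 / p.β) = p.K ^ 2 * a ^ 2 / b ^ (2 / p.β) := by
  have hβ := p.β_pos
  rw [Params.pathLoss, Real.div_rpow (Real.rpow_nonneg (mul_nonneg p.K_pos.le ha) _) hb.le,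
    ← Real.rpow_mul (mul_nonneg p.K_pos.le ha), mul_div_cancel₀ _ hβ.ne', ← mul_pow]
  norm_num

lemma setOf_pathLoss_div_lt {b τ : ℝ} (hb : 0 < b) (hτ : 0 ≤ τ) :
    {u : Plane | p.pathLoss ‖u‖ / b < τ} =
      Metric.ball 0 (Real.sqrt ((τ * b) ^ (2 / p.β)) / p.K) := by
  have hβ := p.β_pos
  have hK := p.K_pos
  ext u
  have h0 : 0 ≤ p.pathLoss ‖u‖ / b := div_nonneg (p.pathLoss_nonneg (norm_nonneg _)) hb.le
  rw [Set.mem_ofPred_eq, mem_ball_zero_iff, lt_div_iff₀ hK,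
    ← Real.rpow_lt_rpow_iff h0 hτ (div_pos two_pos hβ), div_rpow_two_div p (norm_nonneg _) hb,
    div_lt_iff₀ (by positivity), ← Real.mul_rpow hτ hb.le, Real.lt_sqrt (by positivity)]
  rw [mul_pow, mul_comm]

lemma volume_setOf_pathLoss_div_lt {b τ : ℝ} (hb : 0 < b) (hτ : 0 ≤ τ) :
    volume {u : Plane | p.pathLoss ‖u‖ / b < τ} =
      ENNReal.ofReal (Real.pi / p.K ^ 2 * τ ^ (2 / p.β) * b ^ (2 / p.β)) := by
  have hK := p.K_pos
  rw [setOf_pathLoss_div_lt p hb hτ, EuclideanSpace.volume_ball_fin_two,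
    ← ENNReal.ofReal_pow (by positivity), ← ENNReal.ofReal_mul (by positivity), div_pow,
    Real.sq_sqrt (by positivity), Real.mul_rpow hτ hb.le]
  congr 1
  ring

lemma lintegral_exp_neg_mul_sq_norm {b : ℝ} (hb : 0 < b) :
    ∫⁻ u : Plane, ENNReal.ofReal (Real.exp (-b * ‖u‖ ^ 2)) = ENNReal.ofReal (Real.pi / b) := by
  have h := GaussianFourier.integral_rexp_neg_mul_sq_norm (V := Plane) hb
  have h2 : (Real.pi / b) ^ ((Module.finrank ℝ Plane : ℝ) / 2) = Real.pi / b := by simp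
  rw [h2] at h
  rw [← h, ofReal_integral_eq_lintegral_ofReal]
  -- The integral of a non-integrable function is 0 by convention, so a positive value proves
  -- integrability.
  · exact not_imp_comm.1 integral_undef (by rw [h]; positivity)
  · exact ae_of_all _ fun u => (Real.exp_pos _).le

lemma lintegral_exp_neg_pathLoss {a b : ℝ} (ha : 0 < a) (hb : 0 < b) :
    ∫⁻ u : Plane, ENNReal.ofReal (Real.exp (-(a * (p.pathLoss ‖u‖ / b) ^ (2 / p.β)))) =
      ENNReal.ofReal (Real.pi / (a * p.K ^ 2) * b ^ (2 / p.β)) := by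
  have hK := p.K_pos
  have h : ∀ u : Plane, -(a * (p.pathLoss ‖u‖ / b) ^ (2 / p.β)) =
      -(a * p.K ^ 2 / b ^ (2 / p.β)) * ‖u‖ ^ 2 := by
    intro u
    rw [div_rpow_two_div p (norm_nonneg _) hb]
    ring
  simp_rw [h]
  rw [lintegral_exp_neg_mul_sq_norm (by positivity)]
  congr 1
  field_simp

omit [IsProbabilityMeasure Q] in
include hS in
-- For a fixed displacement only one marginal of the field is involved, and all marginals agree.
lemma IsShadowing.lintegral_loss_eq (j : Fin J) {G : ℝ → ℝ≥0∞} (hG : Measurable G) (u : Plane) :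
    ∫⁻ s, G (p.pathLoss ‖u‖ / (p.power j * S s u)) ∂Q =
      ∫⁻ s, G (p.pathLoss ‖u‖ / (p.power j * S s 0)) ∂Q := by
  have hm : Measurable fun σ : ℝ => G (p.pathLoss ‖u‖ / (p.power j * σ)) :=
    hG.comp (measurable_const.div (measurable_const.mul measurable_id))
  exact ((hS.identDistrib u).comp hm).lintegral_eq

include hS in
lemma IsShadowing.lintegral_lintegral_loss (j : Fin J) {G : ℝ → ℝ≥0∞} (hG : Measurable G) :
    ∫⁻ u : Plane, ∫⁻ s, G (p.pathLoss ‖u‖ / (p.power j * S s u)) ∂Q =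
      ∫⁻ s, (∫⁻ u : Plane, G (p.pathLoss ‖u‖ / (p.power j * S s 0))) ∂Q := by
  simp_rw [hS.lintegral_loss_eq p j hG]
  refine lintegral_lintegral_swap (Measurable.aemeasurable ?_)
  exact hG.comp ((p.measurable_pathLoss.comp (measurable_norm.comp measurable_fst)).div
    (measurable_const.mul ((hS.measurable_apply 0).comp measurable_snd)))

variable (hmoment : Integrable (fun s => S s 0 ^ (2 / p.β)) Q)

omit [IsProbabilityMeasure Q] in
include hS hmoment in
lemma IsShadowing.lintegral_power_mul (j : Fin J) {c : ℝ} (hc : 0 ≤ c) :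
    ∫⁻ s, ENNReal.ofReal (c * (p.power j * S s 0) ^ (2 / p.β)) ∂Q =
      ENNReal.ofReal (c * p.power j ^ (2 / p.β) * p.shadowingMoment S Q) := by
  have hP := p.power_pos j
  have h : ∀ s, c * (p.power j * S s 0) ^ (2 / p.β) =
      c * p.power j ^ (2 / p.β) * S s 0 ^ (2 / p.β) := by
    intro s
    rw [Real.mul_rpow hP.le (hS.pos s 0).le, mul_assoc]
  simp_rw [h]
  rw [← ofReal_integral_eq_lintegral_ofReal (hmoment.const_mul _)
    (ae_of_all _ fun s => mul_nonneg (by positivity) (Real.rpow_nonneg (hS.pos s 0).le _)),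
    integral_const_mul, Params.shadowingMoment]

include hS hmoment in
lemma IsShadowing.shadowingMoment_pos : 0 < p.shadowingMoment S Q := by
  refine (integral_pos_iff_support_of_nonneg
    (fun s => Real.rpow_nonneg (hS.pos s 0).le _) hmoment).2 ?_
  have : (Function.support fun s => S s 0 ^ (2 / p.β)) = Set.univ :=
    Set.eq_univ_of_forall fun s => (Real.rpow_pos_of_pos (hS.pos s 0) _).ne'
  simp [this]

include hS hmoment in
lemma IsShadowing.lintegral_measure_loss_lt (j : Fin J) {τ : ℝ} (hτ : 0 ≤ τ) :
    ∫⁻ u : Plane, Q {s | p.pathLoss ‖u‖ / (p.power j * S s u) < τ} =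
      ENNReal.ofReal (Real.pi / p.K ^ 2 * τ ^ (2 / p.β) * p.power j ^ (2 / p.β) *
        p.shadowingMoment S Q) := by
  have hG : Measurable ((Set.Iio τ).indicator fun _ => (1 : ℝ≥0∞)) :=
    measurable_const.indicator measurableSet_Iio
  have h := hS.lintegral_lintegral_loss p j hG
  have h1 : ∀ u, ∫⁻ s, (Set.Iio τ).indicator (fun _ => (1 : ℝ≥0∞))
      (p.pathLoss ‖u‖ / (p.power j * S s u)) ∂Q =
      Q {s | p.pathLoss ‖u‖ / (p.power j * S s u) < τ} := by
    intro u
    rw [← lintegral_indicator_one]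
    · rfl
    · exact measurableSet_lt
        (measurable_const.div (measurable_const.mul (hS.measurable_apply u))) measurable_const
  have h2 : ∀ s, ∫⁻ u : Plane, (Set.Iio τ).indicator (fun _ => (1 : ℝ≥0∞))
      (p.pathLoss ‖u‖ / (p.power j * S s 0)) =
      ENNReal.ofReal (Real.pi / p.K ^ 2 * τ ^ (2 / p.β) * (p.power j * S s 0) ^ (2 / p.β)) := by
    intro s
    rw [← volume_setOf_pathLoss_div_lt p (mul_pos (p.power_pos j) (hS.pos s 0)) hτ,
      ← lintegral_indicator_one]
    · rfl
    · exact measurableSet_lt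
        ((p.measurable_pathLoss.comp measurable_norm).div measurable_const) measurable_const
  simp_rw [h1, h2] at h
  have hK := p.K_pos
  rw [h, hS.lintegral_power_mul p hmoment j (by positivity)]

/-- Loss at `y` of a station of tier `j` at `x`, as an extended nonnegative real. -/
def lossAt (p : Params J) (S : M → Plane → ℝ) (y : Plane) (j : Fin J) (x : Plane) (s : M) :
    ℝ≥0∞ :=
  ENNReal.ofReal (p.pathLoss ‖y - x‖ / (p.power j * S s (y - x)))

omit [IsProbabilityMeasure Q] in
include hS in
lemma IsShadowing.measurable_loss {α : Type*} [MeasurableSpace α] (j : Fin J) {u : α → Plane}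
    {v : α → M} (hu : Measurable u) (hv : Measurable v) :
    Measurable fun a => p.pathLoss ‖u a‖ / (p.power j * S (v a) (u a)) :=
  (p.measurable_pathLoss.comp (measurable_norm.comp hu)).div
    (measurable_const.mul (hS.measurable.comp (hv.prodMk hu)))

omit [IsProbabilityMeasure Q] in
include hS in
lemma IsShadowing.measurable_lossAt (y : Plane) (j : Fin J) :
    Measurable fun q : Plane × M => lossAt p S y j q.1 q.2 :=
  ENNReal.measurable_ofReal.comp
    (hS.measurable_loss p j (measurable_const.sub measurable_fst) measurable_snd)

omit [IsProbabilityMeasure Q] in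
include hS in
lemma IsShadowing.loss_nonneg (j : Fin J) (u : Plane) (s : M) :
    0 ≤ p.pathLoss ‖u‖ / (p.power j * S s u) :=
  div_nonneg (p.pathLoss_nonneg (norm_nonneg _)) (mul_pos (p.power_pos j) (hS.pos s u)).le

variable {p} {Ω : Type*} [MeasurableSpace Ω] {Pr : Measure Ω} [IsProbabilityMeasure Pr]
  {X : Station J → Ω → Plane} {m : Station J → Ω → M} (hnet : IsNetwork p Q X m Pr)

/-- Rate `a` in the law `P(T ≥ τ) = exp (- a τ ^ (2 / β))` of the smallest loss. -/
def Params.lossRate (p : Params J) (S : M → Plane → ℝ) (Q : Measure M) : ℝ :=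
  Real.pi / p.K ^ 2 * p.weightedPower * p.shadowingMoment S Q

lemma Params.weightedPower_pos (p : Params J) (hJ : 0 < J) : 0 < p.weightedPower := by
  have : Nonempty (Fin J) := ⟨⟨0, hJ⟩⟩
  exact Finset.sum_pos (fun j _ => mul_pos (p.intensity_pos j)
    (Real.rpow_pos_of_pos (p.power_pos j) _)) Finset.univ_nonempty

include hS hmoment hnet in
lemma IsNetwork.measure_ofReal_le_minLoss (y : Plane) {τ : ℝ} (hτ : 0 ≤ τ) :
    Pr {ω | ENNReal.ofReal τ ≤
        minLoss fun i : Station J => lossAt p S y i.1 (X i ω) (m i ω)} =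
      ENNReal.ofReal (Real.exp (-(p.lossRate S Q * τ ^ (2 / p.β)))) := by
  have hE := hS.shadowingMoment_pos p hmoment
  have hK := p.K_pos
  have h : ∀ j, ∫⁻ x, Q {s | lossAt p S y j x s < ENNReal.ofReal τ} =
      ENNReal.ofReal (Real.pi / p.K ^ 2 * τ ^ (2 / p.β) * p.power j ^ (2 / p.β) *
        p.shadowingMoment S Q) := by
    intro j
    rw [← hS.lintegral_measure_loss_lt p hmoment j hτ, ← lintegral_sub_left_eq_self
      (fun u => Q {s | p.pathLoss ‖u‖ / (p.power j * S s u) < τ}) y]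
    refine lintegral_congr fun x => ?_
    congr 1
    ext s
    exact ENNReal.ofReal_lt_ofReal_iff_of_nonneg (hS.loss_nonneg p j _ s)
  have hpos : ∀ j, 0 ≤ p.intensity j * (Real.pi / p.K ^ 2 * τ ^ (2 / p.β) *
      p.power j ^ (2 / p.β) * p.shadowingMoment S Q) := by
    intro j
    have := p.intensity_pos j
    have := p.power_pos j
    positivity
  rw [hnet.measure_minLoss_ge_eq_negExp (hS.measurable_lossAt p y)]
  simp_rw [h]
  rw [Finset.sum_congr rfl fun j _ => (ENNReal.ofReal_mul (p.intensity_pos j).le).symm,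
    ← ENNReal.ofReal_sum_of_nonneg fun j _ => hpos j,
    negExp_ofReal (Finset.sum_nonneg fun j _ => hpos j)]
  congr 3
  rw [Params.lossRate, Params.weightedPower, Finset.mul_sum, Finset.sum_mul, Finset.sum_mul]
  exact Finset.sum_congr rfl fun j _ => by ring

include hS hmoment hnet in
/-- Mean area served in the cells of the stations of tier `j` located in `B`. -/
lemma IsNetwork.lintegral_tsum_measure_loss_le (j : Fin J) {B : Set Plane} (hB : MeasurableSet B)
    (hB' : volume B < ∞) :
    ∫⁻ y, ∑' n, Pr {ω | X (j, n) ω ∈ B ∧ ∀ k : Station J,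
        lossAt p S y j (X (j, n) ω) (m (j, n) ω) ≤ lossAt p S y k.1 (X k ω) (m k ω)} =
      volume B * ENNReal.ofReal (p.intensity j * p.power j ^ (2 / p.β) / p.weightedPower) := by
  have hE := hS.shadowingMoment_pos p hmoment
  have hW := p.weightedPower_pos j.pos
  have hK := p.K_pos
  have ha : 0 < p.lossRate S Q := by unfold Params.lossRate; positivity
  set G : ℝ → ℝ≥0∞ := fun τ => ENNReal.ofReal (Real.exp (-(p.lossRate S Q * τ ^ (2 / p.β))))
  have hG : Measurable G := by fun_prop
  -- The survival function of the smallest loss is evaluated at the loss of the station itself.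
  have h : ∀ y, ∑' n, Pr {ω | X (j, n) ω ∈ B ∧ ∀ k : Station J,
        lossAt p S y j (X (j, n) ω) (m (j, n) ω) ≤ lossAt p S y k.1 (X k ω) (m k ω)} =
      ENNReal.ofReal (p.intensity j) * ∫⁻ x in B,
        ∫⁻ s, G (p.pathLoss ‖y - x‖ / (p.power j * S s (y - x))) ∂Q := by
    intro y
    rw [hnet.tsum_measure_loss_le (hS.measurable_lossAt p y) j hB hB']
    congr 1
    refine lintegral_congr fun x => lintegral_congr fun s => ?_
    exact hnet.measure_ofReal_le_minLoss hS hmoment y (hS.loss_nonneg p j _ s)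
  have hGm : Measurable fun q : Plane × Plane =>
      ∫⁻ s, G (p.pathLoss ‖q.1 - q.2‖ / (p.power j * S s (q.1 - q.2))) ∂Q :=
    Measurable.lintegral_prod_right' (f := fun z : (Plane × Plane) × M =>
      G (p.pathLoss ‖z.1.1 - z.1.2‖ / (p.power j * S z.2 (z.1.1 - z.1.2))))
      (hG.comp (hS.measurable_loss p j ((measurable_fst.comp measurable_fst).sub
        (measurable_snd.comp measurable_fst)) measurable_snd))
  -- The mean area served from `x` does not depend on `x`. The moment of the shadowing from
  -- `lintegral_power_mul` cancels the one in `lossRate`.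
  have hin : ∀ x : Plane, ∫⁻ y : Plane,
      ∫⁻ s, G (p.pathLoss ‖y - x‖ / (p.power j * S s (y - x))) ∂Q =
      ENNReal.ofReal (p.power j ^ (2 / p.β) / p.weightedPower) := by
    intro x
    rw [lintegral_sub_right_eq_self
      (fun u => ∫⁻ s, G (p.pathLoss ‖u‖ / (p.power j * S s u)) ∂Q) x,
      hS.lintegral_lintegral_loss p j hG]
    simp_rw [G, fun s => lintegral_exp_neg_pathLoss p ha (mul_pos (p.power_pos j) (hS.pos s 0))]
    rw [hS.lintegral_power_mul p hmoment j (by positivity), Params.lossRate]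
    congr 1
    field_simp
  simp_rw [h]
  rw [lintegral_const_mul' _ _ ENNReal.ofReal_ne_top, lintegral_lintegral_swap hGm.aemeasurable]
  simp_rw [hin]
  rw [lintegral_const, Measure.restrict_apply_univ, mul_div_assoc,
    ENNReal.ofReal_mul (p.intensity_pos j).le]
  ring

end Loss

/-! ### Palm means and translation invariance -/

section Palm

variable {J : ℕ} {p : Params J} {M : Type*} [MeasurableSpace M] {Q : Measure M}
  [IsProbabilityMeasure Q] {S : M → Plane → ℝ} (hS : IsShadowing S Q)

omit [MeasurableSpace M] in
lemma cell_shift (c : Config J M) (x : Plane) (i : Station J) :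
    cell p S (c.shift x) i = (fun y => y + x) ⁻¹' cell p S c i := by
  ext y
  have h : ∀ z : Plane, y - (z - x) = y + x - z := fun z => by abel
  simp only [cell, propagationLoss, Config.shift, Set.mem_ofPred_eq, Set.mem_preimage, h]

omit [MeasurableSpace M] in
-- This removes the recentring at the typical station from the Palm integrals.
lemma trafficDemand_shift (c : Config J M) (x : Plane) (i : Station J) :
    trafficDemand p S (c.shift x) i = trafficDemand p S c i := by
  rw [trafficDemand, trafficDemand, cell_shift, measure_preimage_add_right]

omit [IsProbabilityMeasure Q] in
include hS in
lemma IsShadowing.measurableSet_cell {α : Type*} [MeasurableSpace α] {c : α → Config J M}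
    (hc : Measurable c) (i : Station J) :
    MeasurableSet {q : α × Plane | q.2 ∈ cell p S (c q.1) i} := by
  have h : ∀ k : Station J, Measurable fun q : α × Plane =>
      propagationLoss p S (c q.1) k q.2 := by
    intro k
    have hk : Measurable fun q : α × Plane => c q.1 k :=
      (measurable_pi_apply k).comp (hc.comp measurable_fst)
    exact hS.measurable_loss p k.1 (measurable_snd.sub (measurable_fst.comp hk))
      (measurable_snd.comp hk)
  have he : {q : α × Plane | q.2 ∈ cell p S (c q.1) i} = ⋂ k : Station J,
      {q | propagationLoss p S (c q.1) i q.2 ≤ propagationLoss p S (c q.1) k q.2} := by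
    ext q
    simp [cell]
  rw [he]
  exact MeasurableSet.iInter fun k => measurableSet_le (h i) (h k)

omit [IsProbabilityMeasure Q] in
include hS in
lemma IsShadowing.measurable_trafficDemand :
    Measurable fun q : Station J × Config J M => trafficDemand p S q.2 q.1 :=
  measurable_from_prod_countable_right fun i =>
    (measurable_measure_prodMk_left (hS.measurableSet_cell (p := p) measurable_id i)).const_mul _

omit [MeasurableSpace M] in
lemma mem_cell_iff (hpos : ∀ s y, 0 < S s y) (c : Config J M) (i : Station J) (y : Plane) :
    y ∈ cell p S c i ↔ ∀ k : Station J,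
      lossAt p S y i.1 (c i).1 (c i).2 ≤ lossAt p S y k.1 (c k).1 (c k).2 := by
  refine forall_congr' fun k => (ENNReal.ofReal_le_ofReal_iff ?_).symm
  exact div_nonneg (p.pathLoss_nonneg (norm_nonneg _)) (mul_pos (p.power_pos _) (hpos _ _)).le

variable {Ω : Type*} [MeasurableSpace Ω] {Pr : Measure Ω} [IsProbabilityMeasure Pr]
  {X : Station J → Ω → Plane} {m : Station J → Ω → M} (hnet : IsNetwork p Q X m Pr)
  {B : Set Plane}

include hnet

omit [IsProbabilityMeasure Pr] [IsProbabilityMeasure Q] in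
lemma IsNetwork.measurable_config : Measurable fun ω => config X m ω :=
  measurable_pi_lambda _ fun i => (hnet.measurable_location i).prodMk (hnet.mark_measurable i)

omit [IsProbabilityMeasure Pr] [IsProbabilityMeasure Q] in
lemma IsNetwork.measurable_shift (i : Station J) :
    Measurable fun ω => (i, (config X m ω).shift (X i ω)) :=
  measurable_const.prodMk <| measurable_pi_lambda _ fun k =>
    ((hnet.measurable_location k).sub (hnet.measurable_location i)).prodMk
      (hnet.mark_measurable k)

omit [IsProbabilityMeasure Pr] [IsProbabilityMeasure Q] in
lemma IsNetwork.lintegral_palm {F : Station J × Config J M → ℝ≥0∞} (hF : Measurable F) :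
    ∫⁻ q, F q ∂(palm p X m Pr B) =
      (ENNReal.ofReal p.totalIntensity * volume B)⁻¹ *
        ∑' i, ∫⁻ ω in X i ⁻¹' B, F (i, (config X m ω).shift (X i ω)) ∂Pr := by
  rw [palm, lintegral_smul_measure, lintegral_sum_measure, smul_eq_mul]
  congr 1
  exact tsum_congr fun i => lintegral_map hF (hnet.measurable_shift i)

include hS in
/-- Mean total traffic demand of the stations of tier `j` located in `B`. -/
lemma IsNetwork.tsum_lintegral_trafficDemand (hmoment : Integrable (fun s => S s 0 ^ (2 / p.β)) Q)
    (j : Fin J) (hB : MeasurableSet B) (hB' : volume B < ∞) :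
    ∑' n, ∫⁻ ω in X (j, n) ⁻¹' B, trafficDemand p S (config X m ω) (j, n) ∂Pr =
      ENNReal.ofReal p.demandDensity * (volume B *
        ENNReal.ofReal (p.intensity j * p.power j ^ (2 / p.β) / p.weightedPower)) := by
  have hcell := fun n => hS.measurableSet_cell (p := p) hnet.measurable_config (j, n)
  have hXB : ∀ n, MeasurableSet (X (j, n) ⁻¹' B) := fun n => hnet.measurable_location _ hB
  have hset : ∀ n y, {ω | X (j, n) ω ∈ B ∧ ∀ k : Station J,
        lossAt p S y j (X (j, n) ω) (m (j, n) ω) ≤ lossAt p S y k.1 (X k ω) (m k ω)} =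
      {ω | y ∈ cell p S (config X m ω) (j, n)} ∩ X (j, n) ⁻¹' B := by
    intro n y
    ext ω
    rw [Set.mem_inter_iff, Set.mem_ofPred_eq, Set.mem_ofPred_eq, mem_cell_iff hS.pos, and_comm]
    rfl
  have hm : ∀ n, Measurable fun y =>
      Pr ({ω | y ∈ cell p S (config X m ω) (j, n)} ∩ X (j, n) ⁻¹' B) := fun n =>
    measurable_measure_prodMk_right (μ := Pr) ((hcell n).inter (measurable_fst (hXB n)))
  -- By Fubini, the mean area of a cell is the integral over `y` of the probability that the cell
  -- covers `y`.
  have h : ∀ n, ∫⁻ ω in X (j, n) ⁻¹' B, volume (cell p S (config X m ω) (j, n)) ∂Pr =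
      ∫⁻ y, Pr ({ω | y ∈ cell p S (config X m ω) (j, n)} ∩ X (j, n) ⁻¹' B) := by
    intro n
    have h1 := Measure.prod_apply (μ := Pr.restrict (X (j, n) ⁻¹' B)) (ν := volume) (hcell n)
    have h2 := Measure.prod_apply_symm (μ := Pr.restrict (X (j, n) ⁻¹' B)) (ν := volume) (hcell n)
    exact h1.symm.trans (h2.trans (lintegral_congr fun y =>
      Measure.restrict_apply (measurable_prodMk_right (hcell n))))
  rw [← hnet.lintegral_tsum_measure_loss_le hS hmoment j hB hB']
  simp_rw [hset]
  rw [lintegral_tsum fun n => (hm n).aemeasurable, ← ENNReal.tsum_mul_left]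
  refine tsum_congr fun n => ?_
  rw [← h, ← lintegral_const_mul' _ _ ENNReal.ofReal_ne_top]
  rfl

omit [IsProbabilityMeasure Pr] [IsProbabilityMeasure Q] in
lemma IsNetwork.palm_tier (j : Fin J) (hB : MeasurableSet B) (hB' : volume B < ∞) :
    palm p X m Pr B {q | q.1.1 = j} = (ENNReal.ofReal p.totalIntensity * volume B)⁻¹ *
      (ENNReal.ofReal (p.intensity j) * volume B) := by
  have hs : MeasurableSet {q : Station J × Config J M | q.1.1 = j} :=
    (measurable_fst.comp measurable_fst) (measurableSet_singleton j)
  rw [← lintegral_indicator_one hs, hnet.lintegral_palm (measurable_one.indicator hs),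
    ← (hnet.poisson j).tsum_measure (p.intensity_pos j).le hB hB', ENNReal.tsum_prod',
    tsum_eq_single j]
  · congr 1
    refine tsum_congr fun n => ?_
    simp
  · intro l hl
    simp [hl]

include hS in
lemma IsNetwork.meanDemand_palm (hmoment : Integrable (fun s => S s 0 ^ (2 / p.β)) Q)
    (hB : MeasurableSet B) (hB' : volume B < ∞) :
    meanDemand p S (palm p X m Pr B) = (ENNReal.ofReal p.totalIntensity * volume B)⁻¹ *
      ∑ j, ENNReal.ofReal p.demandDensity * (volume B *
        ENNReal.ofReal (p.intensity j * p.power j ^ (2 / p.β) / p.weightedPower)) := by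
  rw [meanDemand, hnet.lintegral_palm hS.measurable_trafficDemand, ENNReal.tsum_prod', tsum_fintype]
  simp_rw [trafficDemand_shift]
  congr 1
  exact Finset.sum_congr rfl fun j _ => hnet.tsum_lintegral_trafficDemand hS hmoment j hB hB'

include hS in
lemma IsNetwork.meanDemandOfTier_palm (hmoment : Integrable (fun s => S s 0 ^ (2 / p.β)) Q)
    (j : Fin J) (hB : MeasurableSet B) (hB' : volume B < ∞) :
    meanDemandOfTier p S (palm p X m Pr B) j =
      ((ENNReal.ofReal p.totalIntensity * volume B)⁻¹ *
        (ENNReal.ofReal (p.intensity j) * volume B))⁻¹ *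
      ((ENNReal.ofReal p.totalIntensity * volume B)⁻¹ *
        (ENNReal.ofReal p.demandDensity * (volume B *
          ENNReal.ofReal (p.intensity j * p.power j ^ (2 / p.β) / p.weightedPower)))) := by
  have hs : MeasurableSet {q : Station J × Config J M | q.1.1 = j} :=
    (measurable_fst.comp measurable_fst) (measurableSet_singleton j)
  rw [meanDemandOfTier, ProbabilityTheory.cond, lintegral_smul_measure, smul_eq_mul,
    hnet.palm_tier j hB hB', ← lintegral_indicator hs,
    hnet.lintegral_palm (hS.measurable_trafficDemand.indicator hs), ENNReal.tsum_prod',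
    tsum_eq_single j]
  · rw [← hnet.tsum_lintegral_trafficDemand hS hmoment j hB hB']
    simp [trafficDemand_shift]
  · intro l hl
    simp [hl]

omit hnet

/-- The exponents β/2 and 2/β cancel, so P^(2/β) is the intensity-weighted mean of the P_j^(2/β). -/
lemma Params.equivalentPower_rpow (p : Params J) :
    p.equivalentPower ^ (2 / p.β) = p.weightedPower / p.totalIntensity := by
  have hβ := p.β_pos
  have hΛ : 0 ≤ p.totalIntensity := Finset.sum_nonneg fun j _ => (p.intensity_pos j).le
  have h : ∑ j, p.intensity j / p.totalIntensity * p.power j ^ (2 / p.β) =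
      p.weightedPower / p.totalIntensity := by
    rw [Params.weightedPower, Finset.sum_div]
    exact Finset.sum_congr rfl fun j _ => by ring
  have h0 : 0 ≤ p.weightedPower := Finset.sum_nonneg fun j _ =>
    mul_nonneg (p.intensity_pos j).le (Real.rpow_nonneg (p.power_pos j).le _)
  rw [Params.equivalentPower, h, ← Real.rpow_mul (div_nonneg h0 hΛ)]
  have : p.β / 2 * (2 / p.β) = 1 := by field_simp
  rw [this, Real.rpow_one]

end Palm

end HetNet

end

theorem proposition1 {J : ℕ} (hJ : 0 < J) (p : HetNet.Params J)
    {M : Type*} [MeasurableSpace M] (Q : Measure M) [IsProbabilityMeasure Q]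
    (S : M → HetNet.Plane → ℝ) (hS : HetNet.IsShadowing S Q)
    (hmoment : Integrable (fun m => S m 0 ^ (2 / p.β)) Q)
    {Ω : Type*} [MeasurableSpace Ω] (Pr : Measure Ω) [IsProbabilityMeasure Pr]
    (X : HetNet.Station J → Ω → HetNet.Plane) (m : HetNet.Station J → Ω → M)
    (hnet : HetNet.IsNetwork p Q X m Pr)
    (B : Set HetNet.Plane) (hB : MeasurableSet B) (hB0 : 0 < volume B) (hB1 : volume B < ∞) :
    HetNet.meanDemand p S (HetNet.palm p X m Pr B) =
        ENNReal.ofReal (p.demandDensity / p.totalIntensity) ∧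
      ∀ j : Fin J,
        HetNet.meanDemandOfTier p S (HetNet.palm p X m Pr B) j =
          HetNet.meanDemand p S (HetNet.palm p X m Pr B) *
            ENNReal.ofReal (p.power j ^ (2 / p.β) / p.equivalentPower ^ (2 / p.β)) := by
  have hW := p.weightedPower_pos hJ
  have hρ : 0 < p.demandDensity := div_pos p.γ_pos p.μ_pos
  have hΛ : 0 < p.totalIntensity :=
    Finset.sum_pos (fun j _ => p.intensity_pos j) ⟨⟨0, hJ⟩, Finset.mem_univ _⟩
  -- With the area of `B` written as a positive real, all the [0, ∞] arithmetic reduces to field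
  -- identities in which `b` cancels.
  obtain ⟨b, hb, hbB⟩ : ∃ b : ℝ, 0 < b ∧ volume B = ENNReal.ofReal b :=
    ⟨(volume B).toReal, ENNReal.toReal_pos hB0.ne' hB1.ne, (ENNReal.ofReal_toReal hB1.ne).symm⟩
  have hP := fun j => Real.rpow_pos_of_pos (p.power_pos j) (2 / p.β)
  have hI := p.intensity_pos
  have hmean : HetNet.meanDemand p S (HetNet.palm p X m Pr B) =
      ENNReal.ofReal (p.demandDensity / p.totalIntensity) := by
    -- The shares λ_j P_j^(2/β) / ∑ᵢ λᵢ Pᵢ^(2/β) of the tiers add up to 1, so the total mean demand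
    -- of the stations in `B` is ρ |B|.
    have hsum : ∑ j, p.demandDensity *
        (b * (p.intensity j * p.power j ^ (2 / p.β) / p.weightedPower)) = p.demandDensity * b := by
      rw [← Finset.mul_sum, ← Finset.mul_sum, ← Finset.sum_div]
      change _ * (b * (p.weightedPower / p.weightedPower)) = _
      rw [div_self hW.ne', mul_one]
    have hterm : ∀ j, 0 ≤ p.intensity j * p.power j ^ (2 / p.β) / p.weightedPower :=
      fun j => (div_pos (mul_pos (hI j) (hP j)) hW).le
    rw [hnet.meanDemand_palm hS hmoment hB hB1, hbB]
    simp_rw [← ENNReal.ofReal_mul hb.le, ← ENNReal.ofReal_mul hρ.le]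
    rw [← ENNReal.ofReal_sum_of_nonneg fun j _ =>
        mul_nonneg hρ.le (mul_nonneg hb.le (hterm j)), hsum, ← ENNReal.ofReal_mul hΛ.le,
      ← ENNReal.ofReal_inv_of_pos (by positivity), ← ENNReal.ofReal_mul (by positivity)]
    congr 1
    field_simp
  refine ⟨hmean, fun j => ?_⟩
  have hIj := hI j
  have hPj := hP j
  rw [hmean, hnet.meanDemandOfTier_palm hS hmoment j hB hB1, hbB, p.equivalentPower_rpow,
    ← ENNReal.ofReal_mul hb.le, ← ENNReal.ofReal_mul hρ.le, ← ENNReal.ofReal_mul hΛ.le,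
    ← ENNReal.ofReal_mul hIj.le, ← ENNReal.ofReal_inv_of_pos (by positivity),
    ← ENNReal.ofReal_mul (by positivity), ← ENNReal.ofReal_mul (by positivity),
    ← ENNReal.ofReal_inv_of_pos (by positivity), ← ENNReal.ofReal_mul (by positivity),
    ← ENNReal.ofReal_mul (by positivity)]
  congr 1
  field_simp
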